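/- **Setting.** Let $X$ and $G$ be compact Lie groups with normalised Haar measures $\mu_X,\mu_G$, and let $\{F_t\}_{t\in\mathbb R}$ be a $C^\infty$ measure-preserving flow on $(X,\mu_X)$. Put $V_t\varphi:=\varphi\circ F_t$ for $\varphi\in L^2(X,\mu_X)$, and let $H$ be the generator of the strongly continuous unitary group $\{V_t\}$, normalised so that $V_t=e^{itH}$: $H\varphi:=\lim_{t\to0}(it)^{-1}(V_t-1)\varphi$, with domain $\mathrm{dom}(H)$ the set of $\varphi$ for which the limit exists in $L^2$. Write $(\mathcal L_Yf)(x):=\frac{d}{dt}\big|_{t=0}f(F_t(x))$ for the Lie derivative along the flow; thus $C^\infty(X)\subset\mathrm{dom}(H)$ and $H=-i\mathcal L_Y$ on $C^\infty(X)$. Let $\phi\in C(X;G)$, and let $U_\phi\psi:=\psi\circ T_\phi$ be the Koopman operator in $L^2(X\times G,\mu_X\otimes\mu_G)$ of the skew product $T_\phi(x,g):=(F_1(x),g\,\phi(x))$. Let $\pi=(\pi_{jk})$ be a finite-dimensional irreducible unitary representation of $G$ of dimension $d_\pi$, fix $j\in\{1,\dots,d_\pi\}$, set $$\mathcal H_j^{(\pi)}:=\Big\{\sum_{k=1}^{d_\pi}\varphi_k\otimes\pi_{jk}\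 \Big|\ \varphi_k\in L^2(X,\mu_X)\Big\},$$ and let $U_{\pi,j}:=U_\phi|_{\mathcal H_j^{(\pi)}}$, which is an operator in $\mathcal H_j^{(\pi)}$. Assume that for all $k,\ell$ the function $\pi_{k\ell}\circ\phi$ has a Lie derivative $\mathcal L_Y(\pi_{k\ell}\circ\phi)$ and that $$\int_0^1\frac{dt}t\,\big\|\mathcal L_Y(\pi_{k\ell}\circ\phi)\circ F_t-\mathcal L_Y(\pi_{k\ell}\circ\phi)\big\|_{L^\infty(X)}<\infty .$$ Let $a_1,\dots,a_{d_\pi}\in\mathbb R$ satisfy $(a_k-a_\ell)(\pi_{\ell k}\circ\phi)\equiv0$ for all $k,\ell$, and put $$M_{k\ell}:=-ia_k\big\{\mathcal L_Y(\pi\circ\phi)\cdot(\pi^*\circ\phi)\big\}_{k\ell},\qquad M\sum_k\varphi_k\otimes\pi_{jk}:=\sum_{k,\ell}M_{k\ell}\,\varphi_\ell\otimes\pi_{jk},$$ where $M_{k\ell}$ denotes both the function on $X$ and the operator of multiplication by it in $L^2(X,\mu_X)$. For a self-adjoint operator $A$ in a Hilbert space $\mathcal H$ and a bounded operator $S$ on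 $\mathcal H$, write $S\in C^1(A)$ if $t\mapsto e^{-itA}Se^{itA}$ is strongly of class $C^1$; then $[A,S]$ is the bounded operator such that $-i[A,S]$ is the strong derivative of this map at $t=0$. Write $S\in C^{1+0}(A)$ if moreover $\int_0^1\frac{dt}t\|e^{-itA}[A,S]e^{itA}-[A,S]\|<\infty$. **Lemma.** The functions $M_{k\ell}$ are continuous (so $M$ is bounded), and the following hold. (a) The operator $A\sum_k\varphi_k\otimes\pi_{jk}:=\sum_ka_kH\varphi_k\otimes\pi_{jk}$, $\varphi_k\in C^\infty(X)$, is essentially self-adjoint in $\mathcal H_j^{(\pi)}$, and its closure (denoted by the same symbol) has domain $$\mathrm{dom}(A)=\Big\{\sum_k\varphi_k\otimes\pi_{jk}\ \Big|\ \varphi_k\in L^2(X,\mu_X)\text{ for all }k,\text{ and }\varphi_k\in\mathrm{dom}(H)\text{ for each }k\text{ with }a_k\neq0\Big\}.$$ Furthermore, $e^{itA}\sum_k\varphi_k\otimes\pi_{jk}=\sum_ke^{ita_kH}\varphi_k\otimes\pi_{jk}$ for all $t\in\mathbb R$ and $\varphi_k\in L^2(X,\mu_X)$. (b) For all $k,\ell\in\{1,\dots,d_\pi\}$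 and $t\in\mathbb R$, $$\big\|e^{-ita_kH}M_{k\ell}e^{ita_\ell H}-M_{k\ell}\big\|_{\mathcal B(L^2(X,\mu_X))}=\big\|e^{-ita_kH}M_{k\ell}e^{ita_kH}-M_{k\ell}\big\|_{\mathcal B(L^2(X,\mu_X))}.$$ (c) $U_{\pi,j}\in C^{1+0}(A)$ with $[A,U_{\pi,j}]=MU_{\pi,j}$. -/

import Mathlib

open MeasureTheory Filter Topology Manifold
open scoped ContDiff InnerProductSpace

set_option linter.unusedSectionVars false

noncomputable section

namespace SkewProduct

/-! ### Unbounded operators, unitary groups and regularity classes -/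

section Abstract

variable {E : Type*} [NormedAddCommGroup E] [InnerProductSpace ℂ E] [CompleteSpace E]

/-- A strongly continuous one-parameter unitary group. -/
structure IsUnitaryGroup (W : ℝ → E →L[ℂ] E) : Prop where
  mem_unitary : ∀ t, W t ∈ unitary (E →L[ℂ] E)
  map_add : ∀ s t, W (s + t) = W s ∘L W t
  continuous : ∀ x, Continuous fun t => W t x

/-- The generator `B` of a one-parameter family `W` of bounded operators, normalised so that
`W t = e^{itB}`: `B x = -i lim_{t → 0} t⁻¹ (W t x - W 0 x)`, the domain being the set of those `x`
for which the limit exists. -/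
def generator (W : ℝ → E →L[ℂ] E) : E →ₗ.[ℂ] E where
  domain :=
    { carrier := {x | DifferentiableAt ℝ (fun t => W t x) 0}
      add_mem' := by
        intro x y hx hy
        simp only [Set.mem_ofPred_eq, map_add] at *
        exact hx.fun_add hy
      zero_mem' := by simp
      smul_mem' := by
        intro c x hx
        simp only [Set.mem_ofPred_eq, map_smul] at *
        exact hx.fun_const_smul c }
  toFun :=
    { toFun := fun x => -Complex.I • deriv (fun t => W t (x : E)) 0
      map_add' := by
        rintro ⟨x, hx⟩ ⟨y, hy⟩
        have hx' : DifferentiableAt ℝ (fun t => W t x) 0 := hx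
        have hy' : DifferentiableAt ℝ (fun t => W t y) 0 := hy
        have := deriv_fun_add hx' hy'
        simp [this]
      map_smul' := by
        rintro c ⟨x, hx⟩
        have hx' : DifferentiableAt ℝ (fun t => W t x) 0 := hx
        have := deriv_fun_const_smul c hx'
        simp [this, smul_comm c] }

open Classical in
/-- `expI A t = e^{itA}` for a self-adjoint operator `A`: the strongly continuous one-parameter
unitary group with generator `A` (which exists and is unique by Stone's theorem; the junk value
`0` is taken if `A` does not generate such a group). -/
def expI (A : E →ₗ.[ℂ] E) : ℝ → E →L[ℂ] E :=
  if h : ∃ W : ℝ → E →L[ℂ] E, IsUnitaryGroup W ∧ generator W = A then h.choose else 0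

/-- Essential self-adjointness: the operator is closable and its closure is self-adjoint. -/
def IsEssentiallySelfAdjoint (A : E →ₗ.[ℂ] E) : Prop :=
  A.IsClosable ∧ IsSelfAdjoint A.closure

/-- The conjugated operator `e^{-itA} S e^{itA}`. -/
def conjugated (A : E →ₗ.[ℂ] E) (S : E →L[ℂ] E) (t : ℝ) : E →L[ℂ] E :=
  expI A (-t) ∘L S ∘L expI A t

/-- `S ∈ C¹(A)`: the map `t ↦ e^{-itA} S e^{itA}` is strongly of class `C¹`. -/
def IsC1 (A : E →ₗ.[ℂ] E) (S : E →L[ℂ] E) : Prop :=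
  ∀ x, ContDiff ℝ 1 fun t => conjugated A S t x

/-- The bounded operator `C` is the commutator `[A, S]`, that is, `[iS, A] = -iC` is the strong
derivative of `t ↦ e^{-itA} S e^{itA}` at `t = 0`. -/
def IsCommutator (A : E →ₗ.[ℂ] E) (S C : E →L[ℂ] E) : Prop :=
  ∀ x, HasDerivAt (fun t => conjugated A S t x) (-Complex.I • C x) 0

/-- `S ∈ C^{1+0}(A)`: one has `S ∈ C¹(A)` and
`∫₀¹ ‖e^{-itA} [A, S] e^{itA} - [A, S]‖ dt / t < ∞`. -/
def IsC1Plus (A : E →ₗ.[ℂ] E) (S : E →L[ℂ] E) : Prop :=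
  IsC1 A S ∧ ∃ C : E →L[ℂ] E, IsCommutator A S C ∧
    ∫⁻ t in Set.Ioo (0 : ℝ) 1, ‖conjugated A C t - C‖ₑ / ENNReal.ofReal t < ⊤

end Abstract

/-! ### The base space: flow, Koopman group and multiplication operators -/

section Base

variable {X : Type*} [MeasurableSpace X]

/-- The isometry `φ ↦ φ ∘ f` of `L²` for a measure-preserving map `f`. -/
def koopman {μ : Measure X} (f : X → X) (hf : MeasurePreserving f μ μ) :
    Lp ℂ 2 μ →L[ℂ] Lp ℂ 2 μ :=
  (Lp.compMeasurePreservingₗᵢ ℂ f hf).toContinuousLinearMap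

open Classical in
/-- The operator of multiplication by an essentially bounded function `m` on `L²`
(junk value `0` if `m` is not in `L^∞`). -/
def mulOp (μ : Measure X) (m : X → ℂ) : Lp ℂ 2 μ →L[ℂ] Lp ℂ 2 μ :=
  if h : MemLp m ⊤ μ then (ContinuousLinearMap.mul ℂ ℂ).holderL μ ⊤ 2 2 (h.toLp m) else 0

theorem coeFn_mulOp {μ : Measure X} {m : X → ℂ} (hm : MemLp m ⊤ μ) (f : Lp ℂ 2 μ) :
    mulOp μ m f =ᵐ[μ] fun x => m x * f x := by
  rw [mulOp, dif_pos hm]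
  filter_upwards [(ContinuousLinearMap.mul ℂ ℂ).coeFn_holder (r := 2) (hm.toLp m) f,
    hm.coeFn_toLp] with x h1 h2
  rw [ContinuousLinearMap.holderL_apply_apply, h1, h2]
  rfl

variable [TopologicalSpace X]

/-- The Lie derivative of `f` along the flow `F`: `(ℒ_Y f)(x) = d/dt f(F_t x)` at `t = 0`. -/
def lieDeriv (F : Flow ℝ X) (f : X → ℂ) (x : X) : ℂ :=
  deriv (fun t : ℝ => f (F t x)) 0

/-- The generator `H` of the Koopman group `V_t φ = φ ∘ F_t` of a measure-preserving flow, so that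
`V_t = e^{itH}`. -/
def flowGenerator {μ : Measure X} (F : Flow ℝ X) (hF : ∀ t, MeasurePreserving (F t) μ μ) :
    Lp ℂ 2 μ →ₗ.[ℂ] Lp ℂ 2 μ :=
  generator fun t => koopman (F t) (hF t)

/-- The subspace `C^∞(X)` of `L²(X)`. -/
def smoothL2 (E : Type*) [NormedAddCommGroup E] [NormedSpace ℝ E] [ChartedSpace E X]
    (μ : Measure X) : Submodule ℂ (Lp ℂ 2 μ) where
  carrier := {f | ∃ g : X → ℂ, ContMDiff 𝓘(ℝ, E) 𝓘(ℝ, ℂ) ∞ g ∧ f =ᵐ[μ] g}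
  add_mem' := by
    rintro f f' ⟨g, hg, hfg⟩ ⟨g', hg', hfg'⟩
    exact ⟨g + g', hg.add hg', (Lp.coeFn_add f f').trans (hfg.add hfg')⟩
  zero_mem' := ⟨fun _ => 0, contMDiff_const, Lp.coeFn_zero _ _ _⟩
  smul_mem' := by
    rintro c f ⟨g, hg, hfg⟩
    exact ⟨fun x => c • g x, (contDiff_const_smul c).contMDiff.comp hg,
      (Lp.coeFn_smul c f).trans (hfg.const_smul c)⟩

end Base

/-! ### Irreducible unitary representations and the fibre spaces -/

/-- The representation on `ℂ^d` given by a homomorphism into the unitary group of degree `d`. -/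
def matrixRep {G : Type*} [Group G] {d : ℕ} (ρ : G →* Matrix.unitaryGroup (Fin d) ℂ) :
    Representation ℂ G (Fin d → ℂ) where
  toFun g := Matrix.toLin' (ρ g : Matrix (Fin d) (Fin d) ℂ)
  map_one' := by simp [Module.End.one_eq_id]
  map_mul' g h := by simp [Matrix.toLin'_mul, Module.End.mul_eq_comp]

/-- A continuous irreducible unitary representation of `G` of dimension `d`, in matrix form. -/
structure IUR (G : Type*) [Group G] [TopologicalSpace G] (d : ℕ) where
  /-- the homomorphism into the unitary group of degree `d` -/
  toHom : G →* Matrix.unitaryGroup (Fin d) ℂ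
  continuous_toHom : Continuous toHom
  irreducible : (matrixRep toHom).IsIrreducible

section Rep

variable {G : Type*} [Group G] [TopologicalSpace G] {d : ℕ}

/-- The matrix element `π_{jk}` as a continuous function on `G`. -/
def IUR.entry (π : IUR G d) (j k : Fin d) : C(G, ℂ) where
  toFun g := (π.toHom g : Matrix (Fin d) (Fin d) ℂ) j k
  continuous_toFun :=
    (continuous_subtype_val.comp π.continuous_toHom).matrix_elem j k

theorem IUR.entry_mul (π : IUR G d) (j k : Fin d) (g h : G) :
    π.entry j k (g * h) = ∑ l, π.entry j l g * π.entry l k h := by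
  simp [IUR.entry, Matrix.mul_apply]

theorem IUR.sum_entry (π : IUR G d) (j : Fin d) (g : G) :
    ∑ k, starRingEnd ℂ (π.entry j k g) * π.entry j k g = 1 := by
  have h : (π.toHom g : Matrix (Fin d) (Fin d) ℂ) * star (π.toHom g : Matrix (Fin d) (Fin d) ℂ)
      = 1 := Unitary.mul_star_self_of_mem (π.toHom g).2
  have h' := congrFun (congrFun h j) j
  rw [Matrix.mul_apply, Matrix.one_apply_eq] at h'
  simpa [IUR.entry, mul_comm, Matrix.star_apply] using h'

end Rep

section Fibre

variable {X G : Type*} [MeasurableSpace X] [Group G] [TopologicalSpace G]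
  [IsTopologicalGroup G] [CompactSpace G] [MeasurableSpace G] [BorelSpace G]
  {μ : Measure X} {ν : Measure G}
  [IsProbabilityMeasure μ] [IsProbabilityMeasure ν] {d : ℕ}

theorem memLp_tensor (f : Lp ℂ 2 μ) (ψ : C(G, ℂ)) :
    MemLp (fun p : X × G => f p.1 * ψ p.2) 2 (μ.prod ν) := by
  have h1 : MemLp (fun p : X × G => f p.1) 2 (μ.prod ν) :=
    (Lp.memLp f).comp_measurePreserving measurePreserving_fst
  have h2 : MemLp (fun p : X × G => ψ p.2) ⊤ (μ.prod ν) := by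
    refine MemLp.comp_measurePreserving (f := Prod.snd) (g := ψ) ?_ measurePreserving_snd
    exact memLp_top_of_bound ψ.continuous.measurable.aestronglyMeasurable ‖ψ‖
      (Eventually.of_forall fun x => ψ.norm_coe_le_norm x)
  exact h2.mul h1

/-- The function `f ⊗ ψ : (x, g) ↦ f(x) ψ(g)` in `L²(X × G)`. -/
def tensor (ν : Measure G) [IsProbabilityMeasure ν] (f : Lp ℂ 2 μ) (ψ : C(G, ℂ)) :
    Lp ℂ 2 (μ.prod ν) :=
  (memLp_tensor f ψ).toLp _

theorem coeFn_tensor (f : Lp ℂ 2 μ) (ψ : C(G, ℂ)) :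
    tensor ν f ψ =ᵐ[μ.prod ν] fun p => f p.1 * ψ p.2 :=
  (memLp_tensor f ψ).coeFn_toLp

theorem tensor_add (f f' : Lp ℂ 2 μ) (ψ : C(G, ℂ)) :
    tensor ν (f + f') ψ = tensor ν f ψ + tensor ν f' ψ := by
  rw [tensor, tensor, tensor, ← MemLp.toLp_add]
  refine MemLp.toLp_congr _ _ ?_
  filter_upwards [measurePreserving_fst.quasiMeasurePreserving.ae (Lp.coeFn_add f f')] with p hp
  rw [hp]; simp [add_mul]

theorem tensor_smul (c : ℂ) (f : Lp ℂ 2 μ) (ψ : C(G, ℂ)) :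
    tensor ν (c • f) ψ = c • tensor ν f ψ := by
  rw [tensor, tensor, ← MemLp.toLp_const_smul]
  refine MemLp.toLp_congr _ _ ?_
  filter_upwards [measurePreserving_fst.quasiMeasurePreserving.ae (Lp.coeFn_smul c f)] with p hp
  rw [hp]; simp [mul_assoc]

theorem inner_tensor (f f' : Lp ℂ 2 μ) (ψ ψ' : C(G, ℂ)) :
    ⟪tensor ν f ψ, tensor ν f' ψ'⟫_ℂ
      = ⟪f, f'⟫_ℂ * ∫ g, starRingEnd ℂ (ψ g) * ψ' g ∂ν := by
  rw [L2.inner_def, L2.inner_def, ← integral_prod_mul]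
  refine integral_congr_ae ?_
  filter_upwards [coeFn_tensor (ν := ν) f ψ, coeFn_tensor (ν := ν) f' ψ'] with p h1 h2
  simp only [h1, h2, RCLike.inner_apply, map_mul]
  ring

variable (μ ν) in
/-- The map `(φ_k)_k ↦ ∑_k φ_k ⊗ π_{jk}`. -/
def tensorSum (π : IUR G d) (j : Fin d) : (Fin d → Lp ℂ 2 μ) →ₗ[ℂ] Lp ℂ 2 (μ.prod ν) where
  toFun f := ∑ k, tensor ν (f k) (π.entry j k)
  map_add' f f' := by simp [tensor_add, Finset.sum_add_distrib]
  map_smul' c f := by simp [tensor_smul, Finset.smul_sum]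

variable (μ ν) in
/-- The space `ℋ_j^{(π)} = {∑_k φ_k ⊗ π_{jk} | φ_k ∈ L²(X)}`. -/
def fibre (π : IUR G d) (j : Fin d) : Submodule ℂ (Lp ℂ 2 (μ.prod ν)) :=
  LinearMap.range (tensorSum μ ν π j)

variable [ν.IsHaarMeasure]

theorem map_mul_right_eq (g : G) : ν.map (· * g) = ν := by
  have hm : Measurable fun x : G => x * g := (continuous_mul_const g).measurable
  have : IsProbabilityMeasure (ν.map (· * g)) := Measure.isProbabilityMeasure_map hm.aemeasurable
  exact Measure.isHaarMeasure_eq_of_isProbabilityMeasure _ _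

/-- Schur orthogonality for matrix elements in the same row. -/
theorem integral_entry (π : IUR G d) (j k l : Fin d) :
    ∫ g, starRingEnd ℂ (π.entry j k g) * π.entry j l g ∂ν = if k = l then (d : ℂ)⁻¹ else 0 := by
  set B : Matrix (Fin d) (Fin d) ℂ :=
    Matrix.of fun k l => ∫ g, starRingEnd ℂ (π.entry j k g) * π.entry j l g ∂ν with hB
  have hint : ∀ k l, Integrable (fun g => starRingEnd ℂ (π.entry j k g) * π.entry j l g) ν := by
    intro k l
    have hc : Continuous fun g => starRingEnd ℂ (π.entry j k g) * π.entry j l g :=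
      (Complex.continuous_conj.comp (π.entry j k).continuous).mul (π.entry j l).continuous
    exact hc.integrable_of_hasCompactSupport (HasCompactSupport.of_compactSpace _)
  have hinv : ∀ h : G, star (π.toHom h : Matrix (Fin d) (Fin d) ℂ) * B *
      (π.toHom h : Matrix (Fin d) (Fin d) ℂ) = B := by
    intro h
    ext k l
    have hm : Measurable fun x : G => x * h := (continuous_mul_const h).measurable
    have hc : Continuous fun g => starRingEnd ℂ (π.entry j k g) * π.entry j l g :=
      (Complex.continuous_conj.comp (π.entry j k).continuous).mul (π.entry j l).continuous
    have h1 : B k l = ∫ g, starRingEnd ℂ (π.entry j k (g * h)) * π.entry j l (g * h) ∂ν := by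
      have := integral_map (μ := ν) hm.aemeasurable
        (hc.measurable.aestronglyMeasurable (μ := ν.map (· * h)))
      rw [map_mul_right_eq] at this
      exact this
    have h2 : ∀ g, starRingEnd ℂ (π.entry j k (g * h)) * π.entry j l (g * h) =
        ∑ n, ∑ m, starRingEnd ℂ (π.entry m k h) * π.entry n l h *
          (starRingEnd ℂ (π.entry j m g) * π.entry j n g) := by
      intro g
      rw [π.entry_mul, π.entry_mul, map_sum, Finset.sum_mul_sum, Finset.sum_comm]
      refine Finset.sum_congr rfl fun n _ => Finset.sum_congr rfl fun m _ => ?_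
      rw [map_mul]
      ring
    rw [h1]
    simp_rw [h2]
    rw [integral_finsetSum _ fun n _ => integrable_finsetSum _ fun m _ => (hint m n).const_mul _]
    rw [Matrix.mul_apply]
    refine Finset.sum_congr rfl fun n _ => ?_
    rw [integral_finsetSum _ fun m _ => (hint m n).const_mul _, Matrix.mul_apply, Finset.sum_mul]
    refine Finset.sum_congr rfl fun m _ => ?_
    rw [integral_const_mul]
    simp only [hB, Matrix.of_apply, Matrix.star_apply, IUR.entry, ContinuousMap.coe_mk,
      RCLike.star_def]
    ring
  have hcomm : ∀ h : G, B * (π.toHom h : Matrix (Fin d) (Fin d) ℂ) =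
      (π.toHom h : Matrix (Fin d) (Fin d) ℂ) * B := by
    intro h
    have hu : (π.toHom h : Matrix (Fin d) (Fin d) ℂ) *
      star (π.toHom h : Matrix (Fin d) (Fin d) ℂ) = 1 := Unitary.mul_star_self_of_mem (π.toHom h).2
    conv_rhs => rw [← hinv h]
    rw [← mul_assoc, ← mul_assoc, hu, one_mul]
  have := π.irreducible
  let f : Representation.IntertwiningMap (matrixRep π.toHom) (matrixRep π.toHom) :=
    { toLinearMap := Matrix.toLin' B
      isIntertwining' := fun g => by
        change Matrix.toLin' B ∘ₗ Matrix.toLin' _ = Matrix.toLin' _ ∘ₗ Matrix.toLin' B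
        rw [← Matrix.toLin'_mul, ← Matrix.toLin'_mul, hcomm] }
  obtain ⟨c, hc⟩ :=
    (Representation.IsIrreducible.algebraMap_intertwiningMap_bijective_of_isAlgClosed
      (ρ := matrixRep π.toHom)).2 f
  have hBc : B = c • (1 : Matrix (Fin d) (Fin d) ℂ) := by
    apply Matrix.toLin'.injective
    have := congrArg Representation.IntertwiningMap.toLinearMap hc
    rw [show Matrix.toLin' B = f.toLinearMap from rfl, ← this]
    ext i
    simp [Algebra.algebraMap_eq_smul_one]
  have htr : ∑ k, B k k = 1 := by
    simp only [hB, Matrix.of_apply]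
    rw [← integral_finsetSum _ fun k _ => hint k k]
    simp [π.sum_entry]
  have hd : (d : ℂ) * c = 1 := by
    simpa [hBc] using htr
  have hkl : ∫ g, starRingEnd ℂ (π.entry j k g) * π.entry j l g ∂ν = B k l := rfl
  rw [hkl, hBc, eq_inv_of_mul_eq_one_right hd]
  simp [Matrix.one_apply]

theorem inner_tensorSum (π : IUR G d) (j : Fin d) (f f' : Fin d → Lp ℂ 2 μ) :
    ⟪tensorSum μ ν π j f, tensorSum μ ν π j f'⟫_ℂ = (d : ℂ)⁻¹ * ∑ k, ⟪f k, f' k⟫_ℂ := by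
  simp only [tensorSum, LinearMap.coe_mk, AddHom.coe_mk, sum_inner, inner_sum, inner_tensor,
    integral_entry]
  simp [Finset.mul_sum, mul_comm]

theorem norm_sq_tensorSum (π : IUR G d) (j : Fin d) (f : Fin d → Lp ℂ 2 μ) :
    (d : ℝ) * ‖tensorSum μ ν π j f‖ ^ 2 = ∑ k, ‖f k‖ ^ 2 := by
  have hd : (d : ℂ) ≠ 0 := Nat.cast_ne_zero.2 (Fin.pos j).ne'
  have h := inner_tensorSum (ν := ν) π j f f
  simp only [inner_self_eq_norm_sq_to_K] at h
  have h2 : (d : ℂ) * (‖tensorSum μ ν π j f‖ : ℂ) ^ 2 = ∑ k, (‖f k‖ : ℂ) ^ 2 := by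
    rw [show (‖tensorSum μ ν π j f‖ : ℂ) ^ 2 = _ from h, mul_inv_cancel_left₀ hd]
    rfl
  exact_mod_cast h2

variable (μ ν) in
/-- `tensorSum` as a bounded operator. -/
def tensorSumL (π : IUR G d) (j : Fin d) : (Fin d → Lp ℂ 2 μ) →L[ℂ] Lp ℂ 2 (μ.prod ν) :=
  (tensorSum μ ν π j).mkContinuous 1 fun f => by
    have hd : (0 : ℝ) < d := Nat.cast_pos.2 (Fin.pos j)
    have h := norm_sq_tensorSum (ν := ν) π j f
    have h2 : ∑ k, ‖f k‖ ^ 2 ≤ d * ‖f‖ ^ 2 := by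
      calc ∑ k, ‖f k‖ ^ 2 ≤ ∑ _k : Fin d, ‖f‖ ^ 2 :=
            Finset.sum_le_sum fun k _ => by gcongr; exact norm_le_pi_norm f k
        _ = d * ‖f‖ ^ 2 := by simp
    rw [one_mul]
    exact (sq_le_sq₀ (norm_nonneg _) (norm_nonneg _)).1 (le_of_mul_le_mul_left (h ▸ h2) hd)

theorem antilipschitz_tensorSumL (π : IUR G d) (j : Fin d) :
    AntilipschitzWith (NNReal.sqrt d) (tensorSumL μ ν π j) := by
  refine AddMonoidHomClass.antilipschitz_of_bound _ fun f => ?_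
  refine (pi_norm_le_iff_of_nonneg (by positivity)).2 fun k => ?_
  refine abs_le_of_sq_le_sq' ?_ (by positivity) |>.2
  rw [mul_pow, Real.coe_sqrt, NNReal.coe_natCast, Real.sq_sqrt (Nat.cast_nonneg d)]
  rw [show tensorSumL μ ν π j f = tensorSum μ ν π j f from rfl, norm_sq_tensorSum]
  exact Finset.single_le_sum (f := fun k => ‖f k‖ ^ 2) (fun _ _ => by positivity)
    (Finset.mem_univ k)

instance completeSpace_fibre (π : IUR G d) (j : Fin d) : CompleteSpace (fibre μ ν π j) :=
  IsClosed.completeSpace_coe (s := Set.range (tensorSumL μ ν π j))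
    (hs := (antilipschitz_tensorSumL π j).isClosed_range (tensorSumL μ ν π j).uniformContinuous)

variable (μ ν) in
/-- The natural isomorphism `⨁_k L²(X) ≃ ℋ_j^{(π)}`, `(φ_k)_k ↦ ∑_k φ_k ⊗ π_{jk}`. -/
def fibreEquiv (π : IUR G d) (j : Fin d) : (Fin d → Lp ℂ 2 μ) ≃L[ℂ] fibre μ ν π j :=
  (tensorSumL μ ν π j).equivRange (antilipschitz_tensorSumL π j).injective
    ((antilipschitz_tensorSumL π j).isClosed_range (tensorSumL μ ν π j).uniformContinuous)

theorem coe_fibreEquiv (π : IUR G d) (j : Fin d) (f : Fin d → Lp ℂ 2 μ) :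
    (fibreEquiv μ ν π j f : Lp ℂ 2 (μ.prod ν)) = ∑ k, tensor ν (f k) (π.entry j k) := rfl

variable (μ ν) in
/-- The diagonal operator `∑_k φ_k ⊗ π_{jk} ↦ ∑_k a_k T φ_k ⊗ π_{jk}` in `ℋ_j^{(π)}`, with domain
`{∑_k φ_k ⊗ π_{jk} | φ_k ∈ dom(T) for all k}`. -/
def diagonalOp (π : IUR G d) (j : Fin d) (a : Fin d → ℝ) (T : Lp ℂ 2 μ →ₗ.[ℂ] Lp ℂ 2 μ) :
    fibre μ ν π j →ₗ.[ℂ] fibre μ ν π j where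
  domain := (Submodule.pi Set.univ fun _ => T.domain).comap
    ((fibreEquiv μ ν π j).symm : fibre μ ν π j →ₗ[ℂ] (Fin d → Lp ℂ 2 μ))
  toFun :=
    { toFun := fun ψ => fibreEquiv μ ν π j fun k =>
        (a k : ℂ) • T ⟨(fibreEquiv μ ν π j).symm ψ k, ψ.2 k (Set.mem_univ k)⟩
      map_add' := fun ψ ψ' => by
        rw [← map_add]
        congr 1
        ext1 k
        rw [Pi.add_apply, ← smul_add, ← LinearPMap.map_add]
        congr 2
        ext1
        exact congrFun (map_add (fibreEquiv μ ν π j).symm _ _) k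
      map_smul' := fun c ψ => by
        rw [RingHom.id_apply, ← map_smul]
        congr 1
        ext1 k
        rw [Pi.smul_apply, smul_comm c, ← LinearPMap.map_smul T c]
        congr 2
        ext1
        exact congrFun (map_smul (fibreEquiv μ ν π j).symm c _) k }

variable (μ ν) in
/-- The matrix operator `∑_k φ_k ⊗ π_{jk} ↦ ∑_{k,ℓ} T_{kℓ} φ_ℓ ⊗ π_{jk}` in `ℋ_j^{(π)}`. -/
def matrixOp (π : IUR G d) (j : Fin d) (T : Fin d → Fin d → Lp ℂ 2 μ →L[ℂ] Lp ℂ 2 μ) :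
    fibre μ ν π j →L[ℂ] fibre μ ν π j :=
  (fibreEquiv μ ν π j : (Fin d → Lp ℂ 2 μ) →L[ℂ] fibre μ ν π j) ∘L
    (ContinuousLinearMap.pi fun k => ∑ l, T k l ∘L ContinuousLinearMap.proj l) ∘L
      ((fibreEquiv μ ν π j).symm : fibre μ ν π j →L[ℂ] (Fin d → Lp ℂ 2 μ))

end Fibre

/-! ### Skew products -/

section Skew

variable {X G : Type*} [TopologicalSpace X] [MeasurableSpace X] [BorelSpace X]
  [Group G] [TopologicalSpace G] [IsTopologicalGroup G] [CompactSpace G]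
  [SecondCountableTopology G] [MeasurableSpace G] [BorelSpace G]
  {μ : Measure X} {ν : Measure G} [IsProbabilityMeasure μ]
  [IsProbabilityMeasure ν] [ν.IsHaarMeasure] {d : ℕ}

/-- The skew product `T_φ (x, g) = (F_1 x, g φ(x))`. -/
def skewMap (F : Flow ℝ X) (φ : C(X, G)) (p : X × G) : X × G :=
  (F 1 p.1, p.2 * φ p.1)

variable (ν) in
theorem measurePreserving_skewMap (F : Flow ℝ X) (hF : ∀ t, MeasurePreserving (F t) μ μ)
    (φ : C(X, G)) : MeasurePreserving (skewMap F φ) (μ.prod ν) (μ.prod ν) := by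
  refine (hF 1).skew_product (g := fun x g => g * φ x) ?_
    (Eventually.of_forall fun x => map_mul_right_eq (φ x))
  exact measurable_snd.mul (φ.continuous.measurable.comp measurable_fst)

variable (ν) in
/-- The Koopman operator `U_φ ψ = ψ ∘ T_φ` in `L²(X × G)`. -/
def skewKoopman (F : Flow ℝ X) (hF : ∀ t, MeasurePreserving (F t) μ μ) (φ : C(X, G)) :
    Lp ℂ 2 (μ.prod ν) →L[ℂ] Lp ℂ 2 (μ.prod ν) :=
  koopman (skewMap F φ) (measurePreserving_skewMap ν F hF φ)

theorem memLp_entry_comp [CompactSpace X] (π : IUR G d) (φ : C(X, G)) (l k : Fin d) :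
    MemLp (fun x => π.entry l k (φ x)) ⊤ μ :=
  memLp_top_of_bound ((π.entry l k).comp φ).continuous.measurable.aestronglyMeasurable
    ‖(π.entry l k).comp φ‖ (Eventually.of_forall fun x => ((π.entry l k).comp φ).norm_coe_le_norm x)

variable [CompactSpace X]

/-- `U_φ ∑_k φ_k ⊗ π_{jk} = ∑_{k,ℓ} (V_1 φ_k) (π_{ℓk} ∘ φ) ⊗ π_{jℓ}`. -/
theorem skewKoopman_tensorSum (F : Flow ℝ X) (hF : ∀ t, MeasurePreserving (F t) μ μ)
    (φ : C(X, G)) (π : IUR G d) (j : Fin d) (f : Fin d → Lp ℂ 2 μ) :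
    skewKoopman ν F hF φ (tensorSum μ ν π j f) = tensorSum μ ν π j fun l =>
      ∑ k, mulOp μ (fun x => π.entry l k (φ x)) (koopman (F 1) (hF 1) (f k)) := by
  have key : ∀ k, skewKoopman ν F hF φ (tensor ν (f k) (π.entry j k)) =
      ∑ l, tensor ν (mulOp μ (fun x => π.entry l k (φ x)) (koopman (F 1) (hF 1) (f k)))
        (π.entry j l) := by
    intro k
    refine Lp.ext ?_
    have h1 := Lp.coeFn_compMeasurePreserving (tensor ν (f k) (π.entry j k))
      (measurePreserving_skewMap ν F hF φ)
    have h2 := (measurePreserving_skewMap ν F hF φ).quasiMeasurePreserving.ae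
      (coeFn_tensor (ν := ν) (f k) (π.entry j k))
    have h3 : ∀ l, ∀ᵐ p ∂(μ.prod ν), mulOp μ (fun x => π.entry l k (φ x))
        (koopman (F 1) (hF 1) (f k)) p.1 = π.entry l k (φ p.1) * f k (F 1 p.1) := fun l => by
      refine measurePreserving_fst.quasiMeasurePreserving.ae
        (p := fun x => mulOp μ (fun x => π.entry l k (φ x))
          (koopman (F 1) (hF 1) (f k)) x = π.entry l k (φ x) * f k (F 1 x)) ?_
      filter_upwards [coeFn_mulOp (memLp_entry_comp π φ l k) (koopman (F 1) (hF 1) (f k)),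
        Lp.coeFn_compMeasurePreserving (f k) (hF 1)] with x hx hx'
      rw [hx]
      exact congrArg _ hx'
    have h4 := fun l => coeFn_tensor (ν := ν)
      (mulOp μ (fun x => π.entry l k (φ x)) (koopman (F 1) (hF 1) (f k))) (π.entry j l)
    have h5 := Lp.coeFn_fun_finsetSum Finset.univ fun l => tensor ν
      (mulOp μ (fun x => π.entry l k (φ x)) (koopman (F 1) (hF 1) (f k))) (π.entry j l)
    filter_upwards [h1, h2, ae_all_iff.2 h3, ae_all_iff.2 h4, h5] with p h1 h2 h3 h4 h5
    rw [h5]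
    refine h1.trans ?_
    rw [Function.comp_apply, h2]
    simp only [h4, h3, skewMap, π.entry_mul, Finset.mul_sum]
    exact Finset.sum_congr rfl fun l _ => by ring
  simp only [tensorSum, LinearMap.coe_mk, AddHom.coe_mk, map_sum, key]
  rw [Finset.sum_comm]
  refine Finset.sum_congr rfl fun l _ => ?_
  exact (map_sum (⟨⟨fun f : Lp ℂ 2 μ => tensor ν f (π.entry j l), by
    simpa using tensor_smul (ν := ν) (0 : ℂ) (0 : Lp ℂ 2 μ) (π.entry j l)⟩,
      fun f f' => tensor_add f f' _⟩ : Lp ℂ 2 μ →+ Lp ℂ 2 (μ.prod ν)) _ _).symm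

variable (ν) in
/-- The restriction `U_{π,j}` of the Koopman operator `U_φ` to `ℋ_j^{(π)}`. -/
def fibreKoopman (F : Flow ℝ X) (hF : ∀ t, MeasurePreserving (F t) μ μ) (φ : C(X, G))
    (π : IUR G d) (j : Fin d) : fibre μ ν π j →L[ℂ] fibre μ ν π j :=
  (skewKoopman ν F hF φ).restrict (p := fibre μ ν π j) (q := fibre μ ν π j) <| by
    rintro _ ⟨f, rfl⟩
    exact ⟨_, (skewKoopman_tensorSum F hF φ π j f).symm⟩

/-- The assumption on the cocycle: all `π_{kℓ} ∘ φ` have a Lie derivative along the flow, which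
satisfies `∫₀¹ ‖ℒ_Y(π_{kℓ} ∘ φ) ∘ F_t - ℒ_Y(π_{kℓ} ∘ φ)‖_{L^∞(X)} dt / t < ∞`. -/
structure CocycleAssumption (μ : Measure X) (F : Flow ℝ X) (φ : C(X, G)) (π : IUR G d) : Prop where
  differentiable : ∀ k l x, DifferentiableAt ℝ (fun t : ℝ => π.entry k l (φ (F t x))) 0
  dini : ∀ k l, ∫⁻ t in Set.Ioo (0 : ℝ) 1,
    eLpNorm (fun x => lieDeriv F (fun y => π.entry k l (φ y)) (F t x) -
      lieDeriv F (fun y => π.entry k l (φ y)) x) ⊤ μ / ENNReal.ofReal t < ⊤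

/-- The function `M_{kℓ} = -i a_k {ℒ_Y(π ∘ φ) · (π^* ∘ φ)}_{kℓ}`. -/
def commutatorEntry (F : Flow ℝ X) (φ : C(X, G)) (π : IUR G d) (a : Fin d → ℝ) (k l : Fin d)
    (x : X) : ℂ :=
  -Complex.I * (a k : ℂ) *
    ∑ m, lieDeriv F (fun y => π.entry k m (φ y)) x * starRingEnd ℂ (π.entry l m (φ x))

/-- The bounded operator `M_{kℓ}` of multiplication by the function `M_{kℓ}` in `L²(X)`. -/
def commutatorEntryOp (μ : Measure X) (F : Flow ℝ X) (φ : C(X, G)) (π : IUR G d) (a : Fin d → ℝ)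
    (k l : Fin d) : Lp ℂ 2 μ →L[ℂ] Lp ℂ 2 μ :=
  mulOp μ (commutatorEntry F φ π a k l)

/-- The matrix multiplication operator `M ∑_k φ_k ⊗ π_{jk} = ∑_{k,ℓ} M_{kℓ} φ_ℓ ⊗ π_{jk}` in
`ℋ_j^{(π)}`. -/
def commutatorOp (μ : Measure X) (ν : Measure G) [IsProbabilityMeasure μ] [IsProbabilityMeasure ν]
    [ν.IsHaarMeasure] (F : Flow ℝ X) (φ : C(X, G)) (π : IUR G d) (j : Fin d) (a : Fin d → ℝ) :
    fibre μ ν π j →L[ℂ] fibre μ ν π j :=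
  matrixOp μ ν π j (commutatorEntryOp μ F φ π a)

/-- The operator `A ∑_k φ_k ⊗ π_{jk} = ∑_k a_k H φ_k ⊗ π_{jk}`, `φ_k ∈ C^∞(X)`, in `ℋ_j^{(π)}`
(before taking the closure). -/
def conjugateOp (E : Type*) [NormedAddCommGroup E] [NormedSpace ℝ E] [ChartedSpace E X]
    (ν : Measure G) [IsProbabilityMeasure ν] [ν.IsHaarMeasure]
    (F : Flow ℝ X) (hF : ∀ t, MeasurePreserving (F t) μ μ) (π : IUR G d) (j : Fin d)
    (a : Fin d → ℝ) : fibre μ ν π j →ₗ.[ℂ] fibre μ ν π j :=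
  diagonalOp μ ν π j a ((flowGenerator F hF).domRestrict (smoothL2 E μ))

end Skew

end SkewProduct

end

open SkewProduct

noncomputable section

namespace SkewProduct

/-! ### Generators of unitary groups -/

section UnitaryGroup

variable {E : Type*} [NormedAddCommGroup E] [InnerProductSpace ℂ E] [CompleteSpace E]
  {W W' : ℝ → E →L[ℂ] E}

/-! By Schur orthogonality, `fibreEquiv` identifies the fibre space with `L²(X)^d`, up to a scalar
in the norm. There the diagonal family `diag(V_{t a_k})` (`conjugateGroup`) is an explicit unitary
group, and `conjugateOp` is its generator restricted to tuples of smooth functions. That subspace is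
dense and invariant because the flow is smooth, hence it is a core
(`isClosable_and_closure_eq_generator`). So the closure of `A` is the generator and `e^{itA}` is the
diagonal group. A component with `a_k = 0` does not move, so it carries no domain condition. This is
(a).

The operator `U_{π,j}` is `V_1` weighted by the matrix of functions `π_{lk} ∘ φ`. The relation `(a_k
- a_l)(π_{lk} ∘ φ) = 0` says that weights couple only components of equal speed. Conjugation by
`e^{itA}` therefore replaces each weight `c_{lk}` by `c_{lk} ∘ F_{-t a_l}`
(`conjugateGroup_weightedKoopman`), and (c) becomes a statement about continuous functions
transported by the flow. The derivative at `0` has weights `-a_l ℒ_Y(π_{lk} ∘ φ)`; unitarity of `π`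
turns this into `-i M U_{π,j}`. The same vanishing gives `M_{kl} = 0` when `a_k ≠ a_l`, which is
(b).

The analytic point is that `ℒ_Y(π_{kl} ∘ φ)` is only assumed to exist pointwise. The Dini condition
makes the difference quotients converge uniformly, which forces continuity
(`continuous_lieDeriv_of_dini`). After that `L^∞` norms are sup norms, and the Dini integral
survives rescaling of time by `a_l`. -/

theorem mem_graph_generator {p : E × E} :
    p ∈ (generator W).graph ↔ HasDerivAt (fun t => W t p.1) (Complex.I • p.2) 0 := by
  have hI : ∀ v : E, Complex.I • (-Complex.I • v) = v := fun v => by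
    rw [smul_smul]; simp
  constructor
  · rintro h
    obtain ⟨⟨x, hx⟩, h1, h2⟩ := (LinearPMap.mem_graph_iff _).1 h
    have hx' : DifferentiableAt ℝ (fun t => W t x) 0 := hx
    have h3 : -Complex.I • deriv (fun t => W t x) 0 = p.2 := h2
    rw [← h1, ← h3, hI]
    exact hx'.hasDerivAt
  · intro h
    refine (LinearPMap.mem_graph_iff _).2 ⟨⟨p.1, h.differentiableAt⟩, rfl, ?_⟩
    change -Complex.I • deriv (fun t => W t p.1) 0 = p.2
    rw [h.deriv, smul_smul]
    simp

theorem hasDerivAt_mul_of_mem_graph_generator {x y : E} (h : (x, y) ∈ (generator W).graph)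
    (c : ℝ) : HasDerivAt (fun t => W (t * c) x) (Complex.I • ((c : ℂ) • y)) 0 := by
  have h0 : HasDerivAt (fun t => W t x) (Complex.I • y) (0 * c) := by
    rw [zero_mul]
    exact mem_graph_generator.1 h
  have h1 := h0.scomp 0 ((hasDerivAt_id (0 : ℝ)).mul_const c)
  rw [smul_comm]
  simpa [Function.comp_def] using h1

/-- Time is rescaled back by `c⁻¹`. For `c = 0` the orbit is constant and says nothing about `x`,
which is the origin of the condition `a_k ≠ 0` in the domain of `A`. -/
theorem mem_domain_generator_of_mul {x : E} {c : ℝ} (hc : c ≠ 0)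
    (h : DifferentiableAt ℝ (fun t => W (t * c) x) 0) : x ∈ (generator W).domain := by
  change DifferentiableAt ℝ (fun t => W t x) 0
  have h0 : DifferentiableAt ℝ (fun t => W (t * c) x) (0 * c⁻¹) := by rwa [zero_mul]
  have h1 := h0.comp (0 : ℝ) ((differentiableAt_id (𝕜 := ℝ) (x := (0 : ℝ))).mul_const c⁻¹)
  refine h1.congr_of_eventuallyEq (Eventually.of_forall fun t => ?_)
  simp only [Function.comp_apply, id_eq, inv_mul_cancel_right₀ hc]

/-- An isometry has its adjoint as left inverse, and the group law supplies the right inverse `W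
(-t)`; the two must coincide. -/
theorem IsUnitaryGroup.of_norm_map (h0 : W 0 = 1) (hadd : ∀ s t, W (s + t) = W s ∘L W t)
    (hnorm : ∀ t x, ‖W t x‖ = ‖x‖) (hcont : ∀ x, Continuous fun t => W t x) :
    IsUnitaryGroup W where
  map_add := hadd
  continuous := hcont
  mem_unitary t := by
    have h1 : star (W t) * W t = 1 :=
      (ContinuousLinearMap.norm_map_iff_adjoint_comp_self (W t)).1 (hnorm t)
    have h2 : W t * W (-t) = 1 := by
      rw [← h0, ← add_neg_cancel t, hadd]
      rfl
    rw [Unitary.mem_iff]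
    refine ⟨h1, ?_⟩
    rw [left_inv_eq_right_inv h1 h2, h2]

namespace IsUnitaryGroup

variable (hW : IsUnitaryGroup W)
include hW

/-- The group law makes `W 0` idempotent, and an idempotent unitary is the identity. -/
theorem map_zero : W 0 = 1 := by
  have h := hW.map_add 0 0
  rw [add_zero] at h
  have h1 : star (W 0) * W 0 = 1 := (Unitary.mem_iff.1 (hW.mem_unitary 0)).1
  calc W 0 = star (W 0) * W 0 * W 0 := by rw [h1, one_mul]
    _ = star (W 0) * (W 0 ∘L W 0) := mul_assoc _ _ _
    _ = 1 := by rw [← h, h1]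

theorem map_add_apply (s t : ℝ) (x : E) : W (s + t) x = W s (W t x) := by
  rw [hW.map_add]; rfl

theorem map_map_neg (t : ℝ) (x : E) : W t (W (-t) x) = x := by
  rw [← hW.map_add_apply, add_neg_cancel, hW.map_zero]; rfl

theorem inner_map_map (t : ℝ) (x y : E) : ⟪W t x, W t y⟫_ℂ = ⟪x, y⟫_ℂ := by
  have h1 : star (W t) * W t = 1 := (Unitary.mem_iff.1 (hW.mem_unitary t)).1
  rw [← ContinuousLinearMap.adjoint_inner_right]
  exact congrArg (fun z => ⟪x, z⟫_ℂ) (congrArg (fun S : E →L[ℂ] E => S y) h1)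

theorem inner_map_right (t : ℝ) (x y : E) : ⟪x, W t y⟫_ℂ = ⟪W (-t) x, y⟫_ℂ := by
  rw [← hW.inner_map_map t (W (-t) x) y, hW.map_map_neg]

theorem hasDerivAt {x y : E} (h : (x, y) ∈ (generator W).graph) (t : ℝ) :
    HasDerivAt (fun s => W s x) (Complex.I • W t y) t := by
  have h0 : HasDerivAt (fun s => W s x) (Complex.I • y) (t - t) := by
    simpa using mem_graph_generator.1 h
  have h1 := ((W t).restrictScalars ℝ).hasFDerivAt.comp_hasDerivAt t (h0.comp_sub_const t t)
  have h2 : (fun s => W s x) = fun s => W t (W (s - t) x) := by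
    ext s
    rw [← hW.map_add_apply, add_sub_cancel]
  rw [h2]
  simpa [Function.comp_def] using h1

theorem map_mem_graph {x y : E} (h : (x, y) ∈ (generator W).graph) (t : ℝ) :
    (W t x, W t y) ∈ (generator W).graph := by
  refine mem_graph_generator.2 ?_
  have h1 : HasDerivAt (fun s => W s x) (Complex.I • W t y) (0 + t) := by
    simpa using hW.hasDerivAt h t
  have h2 := h1.scomp 0 ((hasDerivAt_id (0 : ℝ)).add_const t)
  simpa [Function.comp_def, hW.map_add_apply] using h2

/-- Symmetry of the generator, obtained by differentiating the constant `⟪W t x, W t x'⟫` at `0`. -/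
theorem inner_graph {x y x' y' : E} (h : (x, y) ∈ (generator W).graph)
    (h' : (x', y') ∈ (generator W).graph) : ⟪y, x'⟫_ℂ = ⟪x, y'⟫_ℂ := by
  have h1 := (mem_graph_generator.1 h).inner ℂ (mem_graph_generator.1 h')
  simp only [hW.inner_map_map, hW.map_zero, one_apply_eq_self] at h1
  have h2 := h1.unique (hasDerivAt_const _ _)
  rw [inner_smul_left, inner_smul_right, Complex.conj_I] at h2
  have h3 : Complex.I * (⟪x, y'⟫_ℂ - ⟪y, x'⟫_ℂ) = 0 := by linear_combination h2
  have h4 := (mul_eq_zero.1 h3).resolve_left Complex.I_ne_zero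
  exact (sub_eq_zero.1 h4).symm

/-- A densely defined restriction of the generator to an invariant domain has the generator as
its adjoint. -/
theorem adjoint_eq_generator {T : E →ₗ.[ℂ] E} (hT : T ≤ generator W)
    (hd : Dense (T.domain : Set E)) (hinv : ∀ t, ∀ x ∈ T.domain, W t x ∈ T.domain) :
    T.adjoint = generator W := by
  refine LinearPMap.eq_of_eq_graph ?_
  rw [LinearPMap.adjoint_graph_eq_graph_adjoint hd]
  have hTg := LinearPMap.le_graph_of_le hT
  ext ⟨y, z⟩
  rw [Submodule.mem_adjoint_iff]
  refine ⟨fun h => ?_, fun h a b hab => ?_⟩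
  · have hc : Continuous fun s => W s (Complex.I • z) := hW.continuous _
    have hint : ∀ t, HasDerivAt (fun t => ∫ s in (0 : ℝ)..t, W s (Complex.I • z))
        (W t (Complex.I • z)) t := fun t =>
      intervalIntegral.integral_hasDerivAt_right (hc.intervalIntegrable _ _)
        hc.aestronglyMeasurable.stronglyMeasurableAtFilter hc.continuousAt
    -- Only the weak relation `T* y = z` is known. Pairing with the dense set of `x ∈ dom T` and
    -- differentiating in `t` yields this integral equation, whose right side is strongly
    -- differentiable; at `t = 0` it gives `(y, z)` in the graph of the generator.
    have key : ∀ t, W t y = y + ∫ s in (0 : ℝ)..t, W s (Complex.I • z) := by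
      intro t
      refine hd.eq_of_inner_right ℂ fun x hx => ?_
      obtain ⟨b, hb⟩ := LinearPMap.mem_domain_iff.1 hx
      have hgb := hTg hb
      have hu : ∀ r : ℝ, HasDerivAt (fun r => ⟪W (-r) x, y⟫_ℂ
          - ⟪x, y + ∫ s in (0 : ℝ)..r, W s (Complex.I • z)⟫_ℂ) 0 r := by
        intro r
        have hr := (hW.hasDerivAt hgb (-r)).scomp r (hasDerivAt_neg r)
        have h1 := hr.inner ℂ (hasDerivAt_const r y)
        have h2 := (hasDerivAt_const r x).inner ℂ ((hint r).const_add y)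
        refine (h1.sub h2).congr_deriv ?_
        -- Invariance of the domain enters here: the adjoint relation has to be used at the moving
        -- vector `W (-r) x`, where `T` agrees with the generator.
        have hmem : (W (-r) x, W (-r) b) ∈ T.graph := by
          obtain ⟨w, hw⟩ := LinearPMap.mem_domain_iff.1 (hinv (-r) x hx)
          have := LinearPMap.mem_graph_snd_inj _ (hTg hw) (hW.map_mem_graph hgb (-r)) rfl
          rwa [← this]
        have h3 := sub_eq_zero.1 (h _ _ hmem)
        simp only at h3
        simp only [Function.comp_apply, inner_zero_right, inner_zero_left, zero_add, add_zero,
          _root_.map_smul, neg_smul, one_smul, inner_neg_left, inner_smul_left, inner_smul_right,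
          Complex.conj_I, h3]
        rw [hW.inner_map_right]
        ring
      have hconst := is_const_of_deriv_eq_zero (fun r => (hu r).differentiableAt)
        (fun r => (hu r).deriv) t 0
      simp only [neg_zero, hW.map_zero, one_apply_eq_self,
        intervalIntegral.integral_same, add_zero, sub_self] at hconst
      rw [hW.inner_map_right]
      exact sub_eq_zero.1 hconst
    refine mem_graph_generator.2 ?_
    have h1 := (hint 0).const_add y
    simp only [← key, hW.map_zero] at h1
    exact h1
  · exact sub_eq_zero.2 (hW.inner_graph (hTg hab) h)

theorem isSelfAdjoint_generator (hd : Dense ((generator W).domain : Set E)) :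
    IsSelfAdjoint (generator W) := by
  refine LinearPMap.isSelfAdjoint_def.2 (hW.adjoint_eq_generator le_rfl hd fun t x hx => ?_)
  obtain ⟨y, hy⟩ := LinearPMap.mem_domain_iff.1 hx
  exact LinearPMap.mem_domain_iff.2 ⟨_, hW.map_mem_graph hy t⟩

/-- A dense invariant subspace of the domain is a core for the generator. -/
theorem isClosable_and_closure_eq_generator {T : E →ₗ.[ℂ] E} (hT : T ≤ generator W)
    (hd : Dense (T.domain : Set E)) (hinv : ∀ t, ∀ x ∈ T.domain, W t x ∈ T.domain) :
    T.IsClosable ∧ T.closure = generator W := by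
  have hadj := hW.adjoint_eq_generator hT hd hinv
  have hclosed : (generator W).IsClosed := hadj ▸ LinearPMap.adjoint_isClosed hd
  have hTc : T.IsClosable := hclosed.isClosable.leIsClosable hT
  refine ⟨hTc, LinearPMap.eq_of_eq_graph ?_⟩
  rw [← hTc.graph_closure_eq_closure_graph]
  refine le_antisymm
    (Submodule.topologicalClosure_minimal _ (LinearPMap.le_graph_of_le hT) hclosed) ?_
  rintro ⟨y, z⟩ hyz
  -- The product `E × E` carries the sup norm; orthogonal complements are taken in its Hilbert space
  -- version.
  set e := (WithLp.linearEquiv 2 ℂ (E × E)).symm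
  have hmem : WithLp.toLp 2 (y, z) ∈ (T.graph.map e.toLinearMap).topologicalClosure := by
    rw [← Submodule.orthogonal_orthogonal_eq_closure, Submodule.mem_orthogonal]
    intro v hv
    -- A vector orthogonal to the graph of `T` is, after rotation, in the graph of `T*`, which is
    -- the generator. Symmetry of the generator then makes it orthogonal to `(y, z)`.
    have hv' : (v.snd, -v.fst) ∈ (generator W).graph := by
      rw [← hadj, LinearPMap.adjoint_graph_eq_graph_adjoint hd, Submodule.mem_adjoint_iff]
      intro a b hab
      have h1 := (Submodule.mem_orthogonal _ _).1 hv (WithLp.toLp 2 (a, b)) ⟨(a, b), hab, rfl⟩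
      rw [WithLp.prod_inner_apply] at h1
      simp only [inner_neg_right, sub_neg_eq_add]
      rw [add_comm]
      exact h1
    have h2 := hW.inner_graph hv' hyz
    rw [inner_neg_left] at h2
    rw [WithLp.prod_inner_apply]
    change ⟪v.fst, y⟫_ℂ + ⟪v.snd, z⟫_ℂ = 0
    rw [← h2]
    ring
  have himg := image_closure_subset_closure_image (s := (T.graph.map e.toLinearMap : Set _))
    (WithLp.prod_continuous_ofLp 2 E E) ⟨_, hmem, rfl⟩
  refine closure_mono ?_ himg
  rintro _ ⟨_, ⟨p, hp, rfl⟩, rfl⟩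
  exact hp

/-- For `x` in the common domain, `‖W r x - W' r x‖²` has zero derivative because the common
generator is symmetric, and it vanishes at `r = 0`. -/
theorem ext_of_generator_eq (hW' : IsUnitaryGroup W') (h : generator W = generator W')
    (hd : Dense ((generator W).domain : Set E)) : W = W' := by
  funext t
  refine ContinuousLinearMap.ext_on (hd.mono Submodule.subset_span) fun x hx => ?_
  obtain ⟨y, hy⟩ := LinearPMap.mem_domain_iff.1 hx
  have hy' : (x, y) ∈ (generator W').graph := h ▸ hy
  have hu : ∀ r : ℝ, HasDerivAt (fun r => ⟪W r x - W' r x, W r x - W' r x⟫_ℂ) 0 r := by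
    intro r
    have h1 := (hW.hasDerivAt hy r).sub (hW'.hasDerivAt hy' r)
    rw [← smul_sub] at h1
    refine (h1.inner ℂ h1).congr_deriv ?_
    have hm : (W r x - W' r x, W r y - W' r y) ∈ (generator W).graph :=
      (generator W).graph.sub_mem (hW.map_mem_graph hy r) (h ▸ hW'.map_mem_graph hy' r)
    have h2 := hW.inner_graph hm hm
    simp only [Pi.sub_apply]
    rw [inner_smul_left, inner_smul_right, h2, Complex.conj_I]
    ring
  have hconst := is_const_of_deriv_eq_zero (fun r => (hu r).differentiableAt)
    (fun r => (hu r).deriv) t 0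
  simp only [hW.map_zero, hW'.map_zero, sub_self, inner_self_eq_zero, inner_zero_left] at hconst
  exact sub_eq_zero.1 hconst

/-- `expI` is defined by choice; uniqueness of the group with a given generator identifies the
chosen one. -/
theorem expI_generator (hd : Dense ((generator W).domain : Set E)) :
    expI (generator W) = W := by
  have h : ∃ V : ℝ → E →L[ℂ] E, IsUnitaryGroup V ∧ generator V = generator W := ⟨W, hW, rfl⟩
  rw [expI, dif_pos h]
  exact (hW.ext_of_generator_eq h.choose_spec.1 h.choose_spec.2.symm hd).symm

end IsUnitaryGroup

end UnitaryGroup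

theorem hasDerivAt_clm {V E : Type*} [NormedAddCommGroup V] [NormedSpace ℂ V]
    [NormedAddCommGroup E] [NormedSpace ℂ E] (L : V →L[ℂ] E) {f : ℝ → V} {f' : V} {t : ℝ}
    (h : HasDerivAt f f' t) : HasDerivAt (fun t => L (f t)) (L f') t :=
  (L.restrictScalars ℝ).hasFDerivAt.comp_hasDerivAt t h

/-! ### Transport of continuous functions along a flow -/

section FlowComp

variable {X : Type*} [TopologicalSpace X] [CompactSpace X]

/-- The function `m ∘ F_t`. -/
def flowComp (F : Flow ℝ X) (t : ℝ) (m : C(X, ℂ)) : C(X, ℂ) :=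
  m.comp ⟨F t, F.continuous continuous_const continuous_id⟩

@[simp]
theorem flowComp_apply (F : Flow ℝ X) (t : ℝ) (m : C(X, ℂ)) (x : X) :
    flowComp F t m x = m (F t x) := rfl

theorem continuous_flowComp (F : Flow ℝ X) (m : C(X, ℂ)) :
    Continuous fun t => flowComp F t m :=
  ContinuousMap.continuous_of_continuous_uncurry _ <|
    m.continuous.comp (F.continuous continuous_fst continuous_snd)

theorem norm_flowComp_le (F : Flow ℝ X) (t : ℝ) (m : C(X, ℂ)) : ‖flowComp F t m‖ ≤ ‖m‖ :=
  (ContinuousMap.norm_le _ (norm_nonneg _)).2 fun _ => m.norm_coe_le_norm _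

theorem hasDerivAt_orbit {F : Flow ℝ X} {m m' : X → ℂ}
    (h : ∀ x, HasDerivAt (fun t : ℝ => m (F t x)) (m' x) 0) (t : ℝ) (x : X) :
    HasDerivAt (fun s : ℝ => m (F s x)) (m' (F t x)) t := by
  have h0 : HasDerivAt (fun s : ℝ => m (F s (F t x))) (m' (F t x)) (t - t) := by
    simpa using h (F t x)
  simpa [← F.map_add] using h0.comp_sub_const t t

/-- If the derivative along the flow exists pointwise and is continuous, then it exists in the
topology of uniform convergence. -/
theorem hasDerivAt_flowComp {F : Flow ℝ X} {m m' : C(X, ℂ)}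
    (h : ∀ x, HasDerivAt (fun t : ℝ => m (F t x)) (m' x) 0) (t : ℝ) :
    HasDerivAt (fun s => flowComp F s m) (flowComp F t m') t := by
  have hc := continuous_flowComp F m'
  have hint : HasDerivAt (fun t => ∫ s in (0 : ℝ)..t, flowComp F s m') (flowComp F t m') t :=
    intervalIntegral.integral_hasDerivAt_right (hc.intervalIntegrable _ _)
      hc.aestronglyMeasurable.stronglyMeasurableAtFilter hc.continuousAt
  -- The integral is taken in `C(X, ℂ)` with the sup norm. Evaluation at a point commutes with it,
  -- so the identity is the fundamental theorem of calculus on each orbit.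
  have key : (fun s => flowComp F s m) = fun t => m + ∫ s in (0 : ℝ)..t, flowComp F s m' := by
    funext t
    ext x
    have h1 := intervalIntegral.integral_eq_sub_of_hasDerivAt
      (fun s _ => hasDerivAt_orbit h s x)
      ((m'.continuous.comp (F.continuous continuous_id continuous_const)).intervalIntegrable 0 t)
    have h2 := (ContinuousMap.evalCLM ℝ x : C(X, ℂ) →L[ℝ] ℂ).intervalIntegral_comp_comm
      (hc.intervalIntegrable (μ := volume) 0 t)
    simp only [ContinuousMap.evalCLM_apply, flowComp_apply] at h2
    rw [ContinuousMap.add_apply, ← h2, h1]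
    simp
  rw [key]
  exact hint.const_add m

end FlowComp

/-! ### Multiplication operators and the Koopman group -/

section Koopman

variable {X : Type*} [TopologicalSpace X] [CompactSpace X] [MeasurableSpace X] [BorelSpace X]
  {μ : Measure X} [IsProbabilityMeasure μ]

theorem memLp_top_coe (m : C(X, ℂ)) : MemLp m ⊤ μ :=
  memLp_top_of_bound m.continuous.measurable.aestronglyMeasurable ‖m‖
    (Eventually.of_forall fun x => m.norm_coe_le_norm x)

variable (μ) in
/-- The operator of multiplication by a continuous function, as a bounded linear function of the
multiplier. -/
def mulOpL : C(X, ℂ) →L[ℂ] (Lp ℂ 2 μ →L[ℂ] Lp ℂ 2 μ) :=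
  LinearMap.mkContinuous
    { toFun := fun m => mulOp μ m
      map_add' := fun m n => by
        ext1 f
        refine Lp.ext ?_
        filter_upwards [coeFn_mulOp (memLp_top_coe (μ := μ) (m + n)) f,
          coeFn_mulOp (memLp_top_coe (μ := μ) m) f, coeFn_mulOp (memLp_top_coe (μ := μ) n) f,
          Lp.coeFn_add (mulOp μ m f) (mulOp μ n f)] with x h1 h2 h3 h4
        rw [h1, ContinuousMap.add_apply, add_mul, ← h2, ← h3]
        exact h4.symm
      map_smul' := fun c m => by
        ext1 f
        refine Lp.ext ?_
        filter_upwards [coeFn_mulOp (memLp_top_coe (μ := μ) (c • m)) f,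
          coeFn_mulOp (memLp_top_coe (μ := μ) m) f,
          Lp.coeFn_smul c (mulOp μ m f)] with x h1 h2 h4
        rw [h1, ContinuousMap.smul_apply, smul_mul_assoc, ← h2]
        exact h4.symm }
    1 fun m => by
      rw [one_mul]
      refine ContinuousLinearMap.opNorm_le_bound _ (norm_nonneg _) fun f => ?_
      refine Lp.norm_le_mul_norm_of_ae_le_mul ?_
      filter_upwards [coeFn_mulOp (memLp_top_coe (μ := μ) m) f] with x hx
      change ‖mulOp μ m f x‖ ≤ _
      rw [hx, norm_mul]
      exact mul_le_mul_of_nonneg_right (m.norm_coe_le_norm x) (norm_nonneg _)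

theorem coeFn_mulOpL (m : C(X, ℂ)) (f : Lp ℂ 2 μ) : mulOpL μ m f =ᵐ[μ] fun x => m x * f x :=
  coeFn_mulOp (memLp_top_coe m) f

theorem mulOpL_mul_apply (m n : C(X, ℂ)) (f : Lp ℂ 2 μ) :
    mulOpL μ (m * n) f = mulOpL μ m (mulOpL μ n f) := by
  refine Lp.ext ?_
  filter_upwards [coeFn_mulOpL (m * n) f, coeFn_mulOpL m (mulOpL μ n f), coeFn_mulOpL n f]
    with x h1 h2 h3
  rw [h1, h2, h3, ContinuousMap.mul_apply, mul_assoc]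

theorem coeFn_koopman {f : X → X} (hf : MeasurePreserving f μ μ) (g : Lp ℂ 2 μ) :
    koopman f hf g =ᵐ[μ] fun x => g (f x) :=
  Lp.coeFn_compMeasurePreserving g hf

theorem norm_koopman {f : X → X} (hf : MeasurePreserving f μ μ) (g : Lp ℂ 2 μ) :
    ‖koopman f hf g‖ = ‖g‖ :=
  (Lp.compMeasurePreservingₗᵢ ℂ f hf).norm_map g

variable {F : Flow ℝ X} (hF : ∀ t, MeasurePreserving (F t) μ μ)

theorem koopman_toLp (t : ℝ) (m : C(X, ℂ)) :
    koopman (F t) (hF t) (ContinuousMap.toLp 2 μ ℂ m)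
      = ContinuousMap.toLp 2 μ ℂ (flowComp F t m) := by
  refine Lp.ext ?_
  filter_upwards [coeFn_koopman (hF t) (ContinuousMap.toLp 2 μ ℂ m),
    (hF t).quasiMeasurePreserving.ae (ContinuousMap.coeFn_toLp (p := 2) (𝕜 := ℂ) μ m),
    ContinuousMap.coeFn_toLp (p := 2) (𝕜 := ℂ) μ (flowComp F t m)] with x h1 h2 h3
  rw [h1, h2, h3, flowComp_apply]

theorem koopman_zero : koopman (F 0) (hF 0) = 1 := by
  ext1 f
  refine Lp.ext ?_
  filter_upwards [coeFn_koopman (hF 0) f] with x h1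
  rw [h1, F.map_zero_apply]
  rfl

theorem koopman_add (s t : ℝ) :
    koopman (F (s + t)) (hF (s + t)) = koopman (F s) (hF s) ∘L koopman (F t) (hF t) := by
  ext1 f
  refine Lp.ext ?_
  filter_upwards [coeFn_koopman (hF (s + t)) f,
    coeFn_koopman (hF s) (koopman (F t) (hF t) f),
    (hF s).quasiMeasurePreserving.ae (coeFn_koopman (hF t) f)] with x h1 h2 h3
  rw [h1, ContinuousLinearMap.comp_apply, h2, h3, add_comm, F.map_add]

theorem koopman_of_eq_zero {t : ℝ} (ht : t = 0) : koopman (F t) (hF t) = 1 := by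
  subst ht
  exact koopman_zero hF

theorem koopman_koopman {r s t : ℝ} (h : s + t = r) (f : Lp ℂ 2 μ) :
    koopman (F s) (hF s) (koopman (F t) (hF t) f) = koopman (F r) (hF r) f := by
  subst h
  rw [koopman_add]
  rfl

theorem koopman_mulOpL (t : ℝ) (m : C(X, ℂ)) (f : Lp ℂ 2 μ) :
    koopman (F t) (hF t) (mulOpL μ m f)
      = mulOpL μ (flowComp F t m) (koopman (F t) (hF t) f) := by
  refine Lp.ext ?_
  filter_upwards [coeFn_koopman (hF t) (mulOpL μ m f),
    (hF t).quasiMeasurePreserving.ae (coeFn_mulOpL m f),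
    coeFn_mulOpL (flowComp F t m) (koopman (F t) (hF t) f), coeFn_koopman (hF t) f]
    with x h1 h2 h3 h4
  rw [h1, h2, h3, h4, flowComp_apply]

variable [T2Space X] [SecondCountableTopology X]

theorem dense_range_toLp : DenseRange (ContinuousMap.toLp 2 μ ℂ : C(X, ℂ) →L[ℂ] Lp ℂ 2 μ) :=
  ContinuousMap.toLp_denseRange ℂ μ ℂ (by norm_num)

theorem continuous_koopman (f : Lp ℂ 2 μ) : Continuous fun t => koopman (F t) (hF t) f := by
  have hg : Continuous fun t : ℝ =>
      (⟨F t, F.continuous continuous_const continuous_id⟩ : C(X, X)) :=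
    ContinuousMap.continuous_of_continuous_uncurry _ (F.continuous continuous_fst continuous_snd)
  exact (continuous_const (y := f)).compMeasurePreservingLp hg hF (by norm_num)

theorem isUnitaryGroup_koopman : IsUnitaryGroup fun t => koopman (F t) (hF t) :=
  .of_norm_map (koopman_zero hF) (koopman_add hF) (fun t => norm_koopman (hF t))
    (continuous_koopman hF)

/-- Difference quotients converge uniformly, and the inclusion of `C(X, ℂ)` in `L²` is bounded. -/
theorem toLp_mem_graph_flowGenerator {m m' : C(X, ℂ)}
    (h : ∀ x, HasDerivAt (fun t : ℝ => m (F t x)) (m' x) 0) :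
    (ContinuousMap.toLp 2 μ ℂ m, -Complex.I • ContinuousMap.toLp 2 μ ℂ m')
      ∈ (flowGenerator F hF).graph := by
  refine mem_graph_generator.2 ?_
  have h1 := hasDerivAt_clm (ContinuousMap.toLp 2 μ ℂ : C(X, ℂ) →L[ℂ] Lp ℂ 2 μ)
    (hasDerivAt_flowComp h 0)
  have h2 : flowComp F 0 m' = m' := by ext x; simp
  have h3 : Complex.I • -Complex.I • ContinuousMap.toLp 2 μ ℂ m'
      = ContinuousMap.toLp 2 μ ℂ m' := by
    rw [smul_smul]; simp
  simp only [koopman_toLp]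
  rwa [h2, ← h3] at h1

end Koopman

/-! ### Smooth functions -/

section Smooth

variable {E : Type*} [NormedAddCommGroup E] [NormedSpace ℝ E]
  {X : Type*} [TopologicalSpace X] [ChartedSpace E X] [IsManifold 𝓘(ℝ, E) ∞ X]
  {F : Flow ℝ X}
  (hF : ContMDiff (𝓘(ℝ, ℝ).prod 𝓘(ℝ, E)) 𝓘(ℝ, E) ∞ fun p : ℝ × X => F p.1 p.2)
include hF

theorem contMDiff_comp_flow {g : X → ℂ} (hg : ContMDiff 𝓘(ℝ, E) 𝓘(ℝ, ℂ) ∞ g) (t : ℝ) :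
    ContMDiff 𝓘(ℝ, E) 𝓘(ℝ, ℂ) ∞ fun x => g (F t x) :=
  hg.comp (hF.comp (contMDiff_const.prodMk contMDiff_id))

theorem hasDerivAt_lieDeriv {g : X → ℂ} (hg : ContMDiff 𝓘(ℝ, E) 𝓘(ℝ, ℂ) ∞ g) (x : X) :
    HasDerivAt (fun t : ℝ => g (F t x)) (lieDeriv F g x) 0 := by
  have h : ContMDiff 𝓘(ℝ, ℝ) 𝓘(ℝ, ℂ) ∞ fun t : ℝ => g (F t x) :=
    hg.comp (hF.comp (contMDiff_id.prodMk contMDiff_const))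
  exact (h.contDiff.differentiable (by simp) 0).hasDerivAt

theorem continuous_lieDeriv {g : X → ℂ} (hg : ContMDiff 𝓘(ℝ, E) 𝓘(ℝ, ℂ) ∞ g) :
    Continuous (lieDeriv F g) := by
  refine continuous_iff_continuousAt.2 fun x₀ => ?_
  have h1 : ContMDiff (𝓘(ℝ, E).prod 𝓘(ℝ, ℝ)) 𝓘(ℝ, ℂ) ∞
      (Function.uncurry fun (x : X) (t : ℝ) => g (F t x)) :=
    hg.comp (hF.comp (contMDiff_snd.prodMk contMDiff_fst))
  have h2 := ContMDiffAt.mfderiv (m := 0) (fun (x : X) (t : ℝ) => g (F t x)) (fun _ => (0 : ℝ))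
    (h1 (x₀, 0)) contMDiffAt_const (by simp)
  have h3 := h2.continuousAt
  -- The time line and the target are vector spaces, so the tangent coordinate changes are trivial
  -- and an ordinary derivative in `t` remains.
  simp +unfoldPartialApp only [inTangentCoordinates, inCoordinates_tangent_bundle_core_model_space,
    mfderiv_eq_fderiv] at h3
  exact h3.clm_apply (continuousAt_const (y := (1 : ℝ)))

end Smooth

section SmoothL2

variable {E : Type*} [NormedAddCommGroup E] [NormedSpace ℝ E] [FiniteDimensional ℝ E]
  {X : Type*} [TopologicalSpace X] [ChartedSpace E X] [IsManifold 𝓘(ℝ, E) ∞ X]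
  [CompactSpace X] [T2Space X] [SecondCountableTopology X]
  [MeasurableSpace X] [BorelSpace X]
  {μ : Measure X} [IsProbabilityMeasure μ]
  {F : Flow ℝ X}

/-- Continuous functions are dense in `L²`, and smooth functions are uniformly dense among them:
local constants are glued by a smooth partition of unity, the balls of radius `ε` being convex. -/
theorem dense_smoothL2 : Dense (smoothL2 E μ : Set (Lp ℂ 2 μ)) := by
  refine dense_iff_closure_eq.2 (Set.eq_univ_of_univ_subset ?_)
  rw [← (dense_range_toLp (X := X) (μ := μ)).closure_eq]
  refine closure_minimal ?_ isClosed_closure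
  rintro _ ⟨m, rfl⟩
  have hsub : m ∈ closure {n : C(X, ℂ) | ContMDiff 𝓘(ℝ, E) 𝓘(ℝ, ℂ) ∞ n} := by
    refine Metric.mem_closure_iff.2 fun ε hε => ?_
    obtain ⟨g, hg⟩ := exists_contMDiffMap_forall_mem_convex_of_local_const (n := ⊤) 𝓘(ℝ, E)
      (t := fun x => Metric.ball (m x) ε) (fun x => convex_ball _ _) fun x =>
        ⟨m x, (m.continuous.tendsto x).eventually (Metric.ball_mem_nhds (m x) hε) |>.mono
          fun y hy => by rwa [Metric.mem_ball, dist_comm]⟩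
    refine ⟨⟨g, g.contMDiff.continuous⟩, g.contMDiff, ?_⟩
    refine (ContinuousMap.dist_lt_iff hε).2 fun x => ?_
    rw [dist_comm]
    exact hg x
  refine closure_mono ?_ (image_closure_subset_closure_image
    (ContinuousMap.toLp 2 μ ℂ : C(X, ℂ) →L[ℂ] Lp ℂ 2 μ).continuous ⟨m, hsub, rfl⟩)
  rintro _ ⟨n, hn, rfl⟩
  exact ⟨n, hn, ContinuousMap.coeFn_toLp μ n⟩

theorem koopman_mem_smoothL2
    (hF : ContMDiff (𝓘(ℝ, ℝ).prod 𝓘(ℝ, E)) 𝓘(ℝ, E) ∞ fun p : ℝ × X => F p.1 p.2)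
    (hFμ : ∀ t, MeasurePreserving (F t) μ μ) (t : ℝ) {f : Lp ℂ 2 μ} (hf : f ∈ smoothL2 E μ) :
    koopman (F t) (hFμ t) f ∈ smoothL2 E μ := by
  obtain ⟨g, hg, hfg⟩ := hf
  refine ⟨_, contMDiff_comp_flow hF hg t, ?_⟩
  exact (coeFn_koopman (hFμ t) f).trans ((hFμ t).quasiMeasurePreserving.ae hfg)

theorem smoothL2_le_domain
    (hF : ContMDiff (𝓘(ℝ, ℝ).prod 𝓘(ℝ, E)) 𝓘(ℝ, E) ∞ fun p : ℝ × X => F p.1 p.2)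
    (hFμ : ∀ t, MeasurePreserving (F t) μ μ) :
    smoothL2 E μ ≤ (flowGenerator F hFμ).domain := by
  rintro f ⟨g, hg, hfg⟩
  have h := toLp_mem_graph_flowGenerator hFμ (m := ⟨g, hg.continuous⟩)
    (m' := ⟨_, continuous_lieDeriv hF hg⟩) fun x => hasDerivAt_lieDeriv hF hg x
  have hfe : f = ContinuousMap.toLp 2 μ ℂ ⟨g, hg.continuous⟩ :=
    Lp.ext (hfg.trans (ContinuousMap.coeFn_toLp (p := 2) (𝕜 := ℂ) μ ⟨g, hg.continuous⟩).symm)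
  rw [hfe]
  exact LinearPMap.mem_domain_iff.2 ⟨_, h⟩

theorem expI_flowGenerator
    (hF : ContMDiff (𝓘(ℝ, ℝ).prod 𝓘(ℝ, E)) 𝓘(ℝ, E) ∞ fun p : ℝ × X => F p.1 p.2)
    (hFμ : ∀ t, MeasurePreserving (F t) μ μ) (t : ℝ) :
    expI (flowGenerator F hFμ) t = koopman (F t) (hFμ t) :=
  congrFun ((isUnitaryGroup_koopman hFμ).expI_generator
    (dense_smoothL2.mono (smoothL2_le_domain hF hFμ))) t

end SmoothL2

/-! ### Dini continuity along a flow -/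

section Dini

/-- Nonempty open sets have positive measure, so a set of full measure is dense. -/
theorem forall_of_ae_of_isClosed {X : Type*} [TopologicalSpace X] [MeasurableSpace X]
    {μ : Measure X} [μ.IsOpenPosMeasure] {p : X → Prop} (hp : IsClosed {x | p x})
    (h : ∀ᵐ x ∂μ, p x) (x : X) : p x := by
  have h1 := (Measure.dense_of_ae h).closure_eq
  rw [hp.closure_eq] at h1
  exact h1.ge (Set.mem_univ x)

theorem enorm_le_iff_norm_le_toReal {V : Type*} [SeminormedAddGroup V] {v : V} {c : ENNReal}
    (hc : c ≠ ⊤) : ‖v‖ₑ ≤ c ↔ ‖v‖ ≤ c.toReal := by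
  rw [← ofReal_norm, ENNReal.ofReal_le_iff_le_toReal hc]

/-- The essential supremum of `h s` is at most `c` exactly when the section at `s` of `{‖h‖ > c}` is
null, and measures of sections depend measurably on `s`. -/
theorem measurable_eLpNorm_top {Y X : Type*} [MeasurableSpace Y] [MeasurableSpace X]
    {μ : Measure X} [SFinite μ] {h : Y → X → ℂ} (hh : Measurable (Function.uncurry h)) :
    Measurable fun s => eLpNorm (h s) ⊤ μ := by
  refine measurable_of_Iic fun c => ?_
  have hs : MeasurableSet {p : Y × X | ‖Function.uncurry h p‖ₑ ≤ c}ᶜ :=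
    (measurableSet_le hh.enorm measurable_const).compl
  have h2 := measurable_measure_prodMk_left (ν := μ) hs
  convert h2 (measurableSet_singleton 0) using 1
  ext s
  simp only [eLpNorm_exponent_top, Set.mem_preimage, Set.mem_Iic, Set.mem_singleton_iff]
  refine ⟨fun h3 => ?_, fun h3 => eLpNormEssSup_le_of_ae_enorm_bound h3⟩
  have h4 : ∀ᵐ x ∂μ, ‖h s x‖ₑ ≤ c :=
    (ae_le_eLpNormEssSup (f := h s) (μ := μ)).mono fun x hx => hx.trans h3
  exact h4

variable {X : Type*} [TopologicalSpace X] [CompactSpace X]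
  [SecondCountableTopology X] [MeasurableSpace X] [BorelSpace X] {μ : Measure X}
  [IsProbabilityMeasure μ] {F : Flow ℝ X}

/-- Continuity of the Lie derivative is not available yet; measurability is what the Fubini argument
needs. -/
theorem measurable_lieDeriv (m : C(X, ℂ)) : Measurable (lieDeriv F m) := by
  have h := measurable_deriv_with_param (f := fun (x : X) (t : ℝ) => m (F t x))
    (m.continuous.comp (F.continuous continuous_snd continuous_fst))
  exact h.comp (measurable_id.prodMk measurable_const)

theorem measurable_uncurry_lieDeriv_sub (m : C(X, ℂ)) :
    Measurable (Function.uncurry fun (s : ℝ) (x : X) => lieDeriv F m (F s x) - lieDeriv F m x) := by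
  have h := measurable_lieDeriv (F := F) m
  have h2 : Measurable fun p : ℝ × X => F p.1 p.2 :=
    (F.continuous continuous_fst continuous_snd).measurable
  exact (h.comp h2).sub (h.comp measurable_snd)

/-- If a continuous function is differentiable along the flow with a Dini-continuous derivative,
then its difference quotients converge with an explicit rate, almost everywhere. -/
theorem ae_enorm_orbit_sub_le {m : C(X, ℂ)}
    (hd : ∀ x, HasDerivAt (fun t : ℝ => m (F t x)) (lieDeriv F m x) 0)
    (hdini : ∫⁻ t in Set.Ioo (0 : ℝ) 1, eLpNorm (fun x => lieDeriv F m (F t x) -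
      lieDeriv F m x) ⊤ μ / ENNReal.ofReal t < ⊤) :
    ∀ᵐ x ∂μ, ∀ t ∈ Set.Ioo (0 : ℝ) 1, ‖m (F t x) - m x - t * lieDeriv F m x‖ₑ ≤
      ENNReal.ofReal t * ∫⁻ s in Set.Ioo (0 : ℝ) t, eLpNorm (fun x => lieDeriv F m (F s x) -
        lieDeriv F m x) ⊤ μ / ENNReal.ofReal s := by
  set g := lieDeriv F m
  set h : ℝ → X → ℂ := fun s x => g (F s x) - g x
  have hm : Measurable (Function.uncurry h) := measurable_uncurry_lieDeriv_sub m
  -- The null set in `x` a priori depends on `s`. Fubini exchanges the quantifiers and leaves one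
  -- null set that serves every `t`.
  have hae : ∀ᵐ x ∂μ, ∀ᵐ s : ℝ, ‖h s x‖ₑ ≤ eLpNorm (h s) ⊤ μ := by
    have hms : MeasurableSet {p : X × ℝ | ‖h p.2 p.1‖ₑ ≤ eLpNorm (h p.2) ⊤ μ} :=
      measurableSet_le (hm.comp measurable_swap).enorm
        ((measurable_eLpNorm_top (μ := μ) hm).comp measurable_snd)
    refine (Measure.ae_ae_comm (p := fun x s => ‖h s x‖ₑ ≤ eLpNorm (h s) ⊤ μ) hms).2
      (Eventually.of_forall fun s => ?_)
    rw [eLpNorm_exponent_top]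
    exact ae_le_eLpNormEssSup
  filter_upwards [hae] with x hx t ht
  set J := ∫⁻ s in Set.Ioo (0 : ℝ) t, eLpNorm (h s) ⊤ μ / ENNReal.ofReal s
  have hJ : J < ⊤ := (lintegral_mono_set (Set.Ioo_subset_Ioo_right ht.2.le)).trans_lt hdini
  -- Writing `‖h s‖ = s · (‖h s‖ / s)` with `s < t` gains the factor `t`, which later cancels the
  -- denominator of the difference quotient.
  have hle : ∫⁻ s in Set.Ioc (0 : ℝ) t, ‖h s x‖ₑ ≤ ENNReal.ofReal t * J := by
    rw [← setLIntegral_congr Ioo_ae_eq_Ioc, ← lintegral_const_mul' _ _ ENNReal.ofReal_ne_top]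
    refine lintegral_mono_ae ?_
    filter_upwards [ae_restrict_of_ae hx, ae_restrict_mem measurableSet_Ioo] with s hs hst
    refine hs.trans ?_
    have h0 : ENNReal.ofReal s ≠ 0 := (ENNReal.ofReal_pos.2 hst.1).ne'
    calc eLpNorm (h s) ⊤ μ = ENNReal.ofReal s * (eLpNorm (h s) ⊤ μ / ENNReal.ofReal s) :=
          (ENNReal.mul_div_cancel h0 ENNReal.ofReal_ne_top).symm
      _ ≤ _ := by gcongr; exact hst.2.le
  have hint : IntervalIntegrable (fun s => h s x) volume 0 t := by
    rw [intervalIntegrable_iff_integrableOn_Ioc_of_le ht.1.le]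
    refine ⟨(hm.comp (measurable_id.prodMk measurable_const)).aestronglyMeasurable, ?_⟩
    exact hle.trans_lt (ENNReal.mul_lt_top ENNReal.ofReal_lt_top hJ)
  -- The fundamental theorem is used in the form that needs a derivative everywhere and its
  -- integrability, but not its continuity.
  have hder : ∀ s ∈ Set.uIcc 0 t, HasDerivAt (fun s : ℝ => m (F s x) - s * g x) (h s x) s := by
    intro s _
    refine (hasDerivAt_orbit hd s x).sub ?_
    simpa using (Complex.ofRealCLM.hasDerivAt (x := s)).mul_const (g x)
  have hftc := intervalIntegral.integral_eq_sub_of_hasDerivAt hder hint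
  have heq : m (F t x) - m x - t * g x = ∫ s in (0 : ℝ)..t, h s x := by
    rw [hftc, F.map_zero_apply]
    simp
    ring
  rw [heq, intervalIntegral.integral_of_le ht.1.le]
  exact (enorm_integral_le_lintegral_enorm _).trans hle

/-- The continuous difference quotients `D t` converge to the Lie derivative at the rate `J t`, the
tail of the Dini integral near `0`. Once this rate holds at every point, the derivative is a uniform
limit of continuous functions. -/
theorem continuous_lieDeriv_of_dini [μ.IsOpenPosMeasure] {m : C(X, ℂ)}
    (hd : ∀ x, HasDerivAt (fun t : ℝ => m (F t x)) (lieDeriv F m x) 0)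
    (hdini : ∫⁻ t in Set.Ioo (0 : ℝ) 1, eLpNorm (fun x => lieDeriv F m (F t x) -
      lieDeriv F m x) ⊤ μ / ENNReal.ofReal t < ⊤) :
    Continuous (lieDeriv F m) := by
  set g := lieDeriv F m
  set J : ℝ → ENNReal := fun t => ∫⁻ s in Set.Ioo (0 : ℝ) t,
    eLpNorm (fun x => g (F s x) - g x) ⊤ μ / ENNReal.ofReal s
  have hJtop : ∀ t ∈ Set.Ioo (0 : ℝ) 1, J t ≠ ⊤ := fun t ht =>
    ((lintegral_mono_set (Set.Ioo_subset_Ioo_right ht.2.le)).trans_lt hdini).ne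
  -- Absolute continuity of the finite Dini integral.
  have hJ0 : Tendsto (fun t => (J t).toReal) (𝓝[>] 0) (𝓝 0) := by
    have h1 : Tendsto (fun t => ∫⁻ s in Set.Ioo (0 : ℝ) t,
        eLpNorm (fun x => g (F s x) - g x) ⊤ μ / ENNReal.ofReal s
          ∂(volume.restrict (Set.Ioo (0 : ℝ) 1))) (𝓝[>] 0) (𝓝 0) := by
      refine tendsto_setLIntegral_zero hdini.ne ?_
      have h2 : Tendsto (fun t : ℝ => ENNReal.ofReal t) (𝓝[>] 0) (𝓝 0) := by
        have := (ENNReal.continuous_ofReal.tendsto 0).mono_left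
          (nhdsWithin_le_nhds (s := Set.Ioi (0 : ℝ)))
        simpa using this
      refine tendsto_of_tendsto_of_tendsto_of_le_of_le tendsto_const_nhds h2
        (fun _ => zero_le) fun t => ?_
      refine (Measure.restrict_apply_le _ _).trans ?_
      simp
    have h3 : Tendsto J (𝓝[>] 0) (𝓝 0) := by
      refine h1.congr' ?_
      filter_upwards [Ioo_mem_nhdsGT (zero_lt_one (α := ℝ))] with t ht
      rw [Measure.restrict_restrict measurableSet_Ioo,
        Set.inter_eq_left.2 (Set.Ioo_subset_Ioo_right ht.2.le)]
    exact (ENNReal.tendsto_toReal ENNReal.zero_ne_top).comp h3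
  set D : ℝ → X → ℂ := fun t x => (t : ℂ)⁻¹ * (m (F t x) - m x)
  have hDc : ∀ t, Continuous (D t) := fun t => by
    have := m.continuous.comp (F.continuous (continuous_const (y := t)) continuous_id)
    exact continuous_const.mul (this.sub m.continuous)
  have hDlim : ∀ x, Tendsto (fun t => D t x) (𝓝[>] 0) (𝓝 (g x)) := by
    intro x
    have h1 := (hasDerivAt_iff_tendsto_slope.1 (hd x)).mono_left
      (nhdsWithin_mono 0 fun t (ht : 0 < t) => ht.ne')
    refine h1.congr fun t => ?_
    simp only [slope, vsub_eq_sub, sub_zero, F.map_zero_apply, D, Complex.real_smul,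
      Complex.ofReal_inv]
  have hDae : ∀ᵐ x ∂μ, ∀ t ∈ Set.Ioo (0 : ℝ) 1, ‖D t x - g x‖ ≤ (J t).toReal := by
    filter_upwards [ae_enorm_orbit_sub_le hd hdini] with x hx t ht
    have h1 := hx t ht
    rw [enorm_le_iff_norm_le_toReal (ENNReal.mul_ne_top ENNReal.ofReal_ne_top (hJtop t ht)),
      ENNReal.toReal_mul, ENNReal.toReal_ofReal ht.1.le] at h1
    have ht0 : (t : ℂ) ≠ 0 := Complex.ofReal_ne_zero.2 ht.1.ne'
    have h2 : m (F t x) - m x - t * g x = t * (D t x - g x) := by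
      simp only [D]
      field_simp
    rw [h2, norm_mul, Complex.norm_real, Real.norm_of_nonneg ht.1.le] at h1
    exact le_of_mul_le_mul_left h1 ht.1
  -- The derivative may be discontinuous, so its a.e. estimate cannot be extended directly.
  -- Comparing two difference quotients involves only continuous functions, for which a.e. means
  -- everywhere; letting `s → 0` then recovers the derivative at each point.
  have hDD : ∀ t ∈ Set.Ioo (0 : ℝ) 1, ∀ s ∈ Set.Ioo (0 : ℝ) 1, ∀ x,
      ‖D t x - D s x‖ ≤ (J t).toReal + (J s).toReal := by
    intro t ht s hs
    refine forall_of_ae_of_isClosed (μ := μ)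
      (isClosed_le ((hDc t).sub (hDc s)).norm continuous_const) ?_
    filter_upwards [hDae] with x hx
    calc ‖D t x - D s x‖ = ‖(D t x - g x) - (D s x - g x)‖ := by congr 1; ring
      _ ≤ _ := (norm_sub_le _ _).trans (add_le_add (hx t ht) (hx s hs))
  have hD : ∀ t ∈ Set.Ioo (0 : ℝ) 1, ∀ x, ‖D t x - g x‖ ≤ (J t).toReal := by
    intro t ht x
    have h1 := hJ0.const_add (J t).toReal
    rw [add_zero] at h1
    refine le_of_tendsto_of_tendsto ((hDlim x).const_sub (D t x)).norm h1 ?_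
    filter_upwards [Ioo_mem_nhdsGT (zero_lt_one (α := ℝ))] with s hs
    exact hDD t ht s hs x
  have hunif : TendstoUniformly D g (𝓝[>] 0) := by
    refine Metric.tendstoUniformly_iff.2 fun ε hε => ?_
    filter_upwards [Ioo_mem_nhdsGT (zero_lt_one (α := ℝ)), hJ0.eventually_lt_const hε]
      with t ht htε x
    rw [dist_comm, dist_eq_norm]
    exact (hD t ht x).trans_lt htε
  exact hunif.continuous (Frequently.of_forall hDc)

theorem enorm_le_eLpNorm_top [μ.IsOpenPosMeasure] (m : C(X, ℂ)) : ‖m‖ₑ ≤ eLpNorm m ⊤ μ := by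
  by_cases htop : eLpNorm m ⊤ μ = ⊤
  · rw [htop]; exact le_top
  rw [enorm_le_iff_norm_le_toReal htop]
  refine (ContinuousMap.norm_le _ ENNReal.toReal_nonneg).2 ?_
  refine forall_of_ae_of_isClosed (μ := μ) (isClosed_le m.continuous.norm continuous_const) ?_
  rw [eLpNorm_exponent_top] at htop ⊢
  filter_upwards [ae_le_eLpNormEssSup (f := m) (μ := μ)] with x hx
  rwa [enorm_le_iff_norm_le_toReal htop] at hx

/-- The Dini condition along a flow is stable under rescaling of time. -/
theorem lintegral_flowComp_mul_lt_top {m : C(X, ℂ)}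
    (h : ∫⁻ t in Set.Ioo (0 : ℝ) 1, ‖flowComp F t m - m‖ₑ / ENNReal.ofReal t < ⊤) (a : ℝ) :
    ∫⁻ t in Set.Ioo (0 : ℝ) 1, ‖flowComp F (-(t * a)) m - m‖ₑ / ENNReal.ofReal t < ⊤ := by
  set ρ : ℝ → ENNReal := fun t => ‖flowComp F t m - m‖ₑ
  have hρc : Continuous ρ := ((continuous_flowComp F m).sub continuous_const).enorm
  -- `m ∘ F_{-t} - m` is minus the composition of `m ∘ F_t - m` with `F_{-t}`, which does not
  -- increase the sup norm.
  have hneg : ∀ t, ρ (-t) ≤ ρ t := fun t => by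
    have h1 : flowComp F (-t) m - m = -flowComp F (-t) (flowComp F t m - m) := by
      ext x
      simp [← F.map_add]
    simp only [ρ, h1, enorm_neg]
    rw [enorm_le_iff_norm_le]
    exact norm_flowComp_le F (-t) _
  -- The measure `dt / t` is invariant under `u = a t`, so only the range changes, to `(0, a)`. The
  -- part beyond `1` is harmless, since there the integrand is at most `2 ‖m‖`.
  have hpos : ∀ a : ℝ, 0 < a →
      ∫⁻ t in Set.Ioo (0 : ℝ) 1, ρ (a * t) / ENNReal.ofReal t < ⊤ := by
    intro a ha
    set f : ℝ → ENNReal := (Set.Ioo 0 a).indicator fun u => ρ u / ENNReal.ofReal u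
    have hf0 : Measurable fun u : ℝ => ρ u / ENNReal.ofReal u :=
      hρc.measurable.div ENNReal.measurable_ofReal
    have hf : Measurable f := hf0.indicator measurableSet_Ioo
    have h1 : ∀ t ∈ Set.Ioo (0 : ℝ) 1,
        ρ (a * t) / ENNReal.ofReal t = ENNReal.ofReal a * f (a * t) := by
      intro t ht
      have hmem : a * t ∈ Set.Ioo 0 a := ⟨mul_pos ha ht.1, by nlinarith [ht.2]⟩
      rw [show f (a * t) = ρ (a * t) / ENNReal.ofReal (a * t) from Set.indicator_of_mem hmem _,
        ENNReal.ofReal_mul ha.le, ← mul_div_assoc,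
        ENNReal.mul_div_mul_left _ _ (ENNReal.ofReal_pos.2 ha).ne' ENNReal.ofReal_ne_top]
    have h2 : ∫⁻ u, f u < ⊤ := by
      rw [lintegral_indicator measurableSet_Ioo]
      have hsub : Set.Ioo 0 a ⊆ Set.Ioo 0 1 ∪ Set.Icc 1 a := fun u hu => by
        rcases lt_or_ge u 1 with h | h
        · exact Or.inl ⟨hu.1, h⟩
        · exact Or.inr ⟨h, hu.2.le⟩
      refine (lintegral_mono_set hsub).trans_lt ((lintegral_union_le _ _ _).trans_lt ?_)
      refine ENNReal.add_lt_top.2 ⟨h, ?_⟩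
      have hK : ∀ u ∈ Set.Icc 1 a, ρ u / ENNReal.ofReal u ≤ ‖m‖ₑ + ‖m‖ₑ := fun u hu => by
        have h3 : 1 ≤ ENNReal.ofReal u := by simpa using ENNReal.ofReal_le_ofReal hu.1
        calc ρ u / ENNReal.ofReal u ≤ ρ u / 1 := ENNReal.div_le_div_left h3 _
          _ = ρ u := div_one _
          _ ≤ ‖flowComp F u m‖ₑ + ‖m‖ₑ := enorm_sub_le
          _ ≤ _ := by
            gcongr 1
            rw [enorm_le_iff_norm_le]
            exact norm_flowComp_le F u m
      refine (setLIntegral_mono measurable_const hK).trans_lt ?_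
      rw [setLIntegral_const]
      exact ENNReal.mul_lt_top (by simp) (by simp)
    rw [setLIntegral_congr_fun measurableSet_Ioo h1]
    refine (setLIntegral_le_lintegral _ _).trans_lt ?_
    rw [lintegral_const_mul' _ _ ENNReal.ofReal_ne_top,
      ← lintegral_map hf (measurable_const_mul a), Real.map_volume_mul_left ha.ne',
      lintegral_smul_measure]
    exact ENNReal.mul_lt_top ENNReal.ofReal_lt_top
      (ENNReal.mul_lt_top ENNReal.ofReal_lt_top h2)
  rcases lt_trichotomy a 0 with ha | ha | ha
  · have := hpos (-a) (neg_pos.2 ha)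
    convert this using 5 with t
    congr 2
    ring
  · subst ha
    have h0 : flowComp F 0 m = m := by ext x; simp
    simp [h0]
  · refine (lintegral_mono fun t => ?_).trans_lt (hpos a ha)
    rw [mul_comm a t]
    exact ENNReal.div_le_div_right (hneg _) _

end Dini

/-! ### The conjugate operator and its unitary group -/

section ConjugateGroup

variable {X G : Type*} [TopologicalSpace X] [CompactSpace X] [MeasurableSpace X] [BorelSpace X]
  [Group G] [TopologicalSpace G] [IsTopologicalGroup G] [CompactSpace G]
  [MeasurableSpace G] [BorelSpace G]
  {μ : Measure X} {ν : Measure G} [IsProbabilityMeasure μ]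
  [IsProbabilityMeasure ν] [ν.IsHaarMeasure] {d : ℕ}

variable (ν) in
/-- The operator `∑_k φ_k ⊗ π_{jk} ↦ ∑_k (φ_k ∘ F_{t a_k}) ⊗ π_{jk}`. -/
def conjugateGroup (F : Flow ℝ X) (hF : ∀ t, MeasurePreserving (F t) μ μ) (π : IUR G d)
    (j : Fin d) (a : Fin d → ℝ) (t : ℝ) : fibre μ ν π j →L[ℂ] fibre μ ν π j :=
  (fibreEquiv μ ν π j : (Fin d → Lp ℂ 2 μ) →L[ℂ] fibre μ ν π j) ∘L
    (ContinuousLinearMap.pi fun k =>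
      koopman (F (t * a k)) (hF (t * a k)) ∘L ContinuousLinearMap.proj k) ∘L
      ((fibreEquiv μ ν π j).symm : fibre μ ν π j →L[ℂ] (Fin d → Lp ℂ 2 μ))

variable {F : Flow ℝ X} (hF : ∀ t, MeasurePreserving (F t) μ μ) (π : IUR G d) (j : Fin d)
  (a : Fin d → ℝ)

theorem conjugateGroup_fibreEquiv (t : ℝ) (f : Fin d → Lp ℂ 2 μ) :
    conjugateGroup ν F hF π j a t (fibreEquiv μ ν π j f) =
      fibreEquiv μ ν π j fun k => koopman (F (t * a k)) (hF (t * a k)) (f k) := by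
  simp only [conjugateGroup, ContinuousLinearMap.comp_apply, ContinuousLinearEquiv.coe_coe,
    ContinuousLinearEquiv.symm_apply_apply]
  rfl

/-- Tuples carry the sup norm, so `fibreEquiv` is not a multiple of an isometry in general; by Schur
orthogonality the norm of the image is still determined by the norms of the components. -/
theorem norm_fibreEquiv_eq {f f' : Fin d → Lp ℂ 2 μ} (h : ∀ k, ‖f k‖ = ‖f' k‖) :
    ‖fibreEquiv μ ν π j f‖ = ‖fibreEquiv μ ν π j f'‖ := by
  have hd : (d : ℝ) ≠ 0 := Nat.cast_ne_zero.2 (Fin.pos j).ne'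
  have h1 := norm_sq_tensorSum (ν := ν) π j f
  have h2 := norm_sq_tensorSum (ν := ν) π j f'
  simp only [h] at h1
  have h3 := mul_left_cancel₀ hd (h1.trans h2.symm)
  exact (sq_eq_sq₀ (norm_nonneg _) (norm_nonneg _)).1 h3

theorem hasDerivAt_fibreEquiv {u : ℝ → Fin d → Lp ℂ 2 μ} {u' : Fin d → Lp ℂ 2 μ} {t : ℝ} :
    HasDerivAt (fun t => fibreEquiv μ ν π j (u t)) (fibreEquiv μ ν π j u') t ↔
      ∀ k, HasDerivAt (fun t => u t k) (u' k) t := by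
  rw [← hasDerivAt_pi]
  refine ⟨fun h => ?_, fun h =>
    hasDerivAt_clm (fibreEquiv μ ν π j : (Fin d → Lp ℂ 2 μ) →L[ℂ] fibre μ ν π j) h⟩
  have h1 := hasDerivAt_clm
    ((fibreEquiv μ ν π j).symm : fibre μ ν π j →L[ℂ] (Fin d → Lp ℂ 2 μ)) h
  simp only [ContinuousLinearEquiv.coe_coe, ContinuousLinearEquiv.symm_apply_apply] at h1
  exact h1

/-- Differentiability of the orbit is tested component by component, and a component of speed zero
is stationary. -/
theorem fibreEquiv_mem_generator_domain (f : Fin d → Lp ℂ 2 μ) :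
    fibreEquiv μ ν π j f ∈ (generator (conjugateGroup ν F hF π j a)).domain ↔
      ∀ k, a k ≠ 0 → f k ∈ (flowGenerator F hF).domain := by
  rw [LinearPMap.mem_domain_iff]
  constructor
  · rintro ⟨y, hy⟩ k hk
    obtain ⟨u', hu'⟩ := (fibreEquiv μ ν π j).surjective (Complex.I • y)
    have h1 := mem_graph_generator.1 hy
    simp only [conjugateGroup_fibreEquiv, ← hu'] at h1
    exact mem_domain_generator_of_mul hk
      ((hasDerivAt_fibreEquiv π j).1 h1 k).differentiableAt
  · intro h
    have h1 : ∀ k, ∃ y, HasDerivAt (fun t => koopman (F (t * a k)) (hF (t * a k)) (f k))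
        (Complex.I • y) 0 := by
      intro k
      by_cases hk : a k = 0
      · refine ⟨0, ?_⟩
        simp only [hk, mul_zero, smul_zero]
        exact hasDerivAt_const (0 : ℝ) (koopman (F 0) (hF 0) (f k))
      · obtain ⟨y, hy⟩ := LinearPMap.mem_domain_iff.1 (h k hk)
        exact ⟨_, hasDerivAt_mul_of_mem_graph_generator hy (a k)⟩
    choose y hy using h1
    refine ⟨fibreEquiv μ ν π j y, mem_graph_generator.2 ?_⟩
    simp only [conjugateGroup_fibreEquiv, ← map_smul]
    exact (hasDerivAt_fibreEquiv π j).2 hy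

theorem diagonalOp_le_generator {T : Lp ℂ 2 μ →ₗ.[ℂ] Lp ℂ 2 μ} (hT : T ≤ flowGenerator F hF) :
    diagonalOp μ ν π j a T ≤ generator (conjugateGroup ν F hF π j a) := by
  refine LinearPMap.le_of_le_graph ?_
  rintro ⟨x, y⟩ h
  obtain ⟨ψ, h1, h2⟩ := (LinearPMap.mem_graph_iff _).1 h
  simp only at h1 h2
  subst h1 h2
  refine mem_graph_generator.2 ?_
  set f := (fibreEquiv μ ν π j).symm ψ with hf
  have hψ : (ψ : fibre μ ν π j) = fibreEquiv μ ν π j f :=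
    ((fibreEquiv μ ν π j).apply_symm_apply _).symm
  have hdom : ∀ k, f k ∈ T.domain := fun k => ψ.2 k (Set.mem_univ k)
  have hsmul : Complex.I • diagonalOp μ ν π j a T ψ = fibreEquiv μ ν π j fun k =>
      Complex.I • ((a k : ℂ) • T ⟨f k, hdom k⟩) :=
    (map_smul (fibreEquiv μ ν π j) Complex.I
      (fun k => (a k : ℂ) • T ⟨f k, hdom k⟩)).symm
  have hfun : (fun t => conjugateGroup ν F hF π j a t ψ) = fun t => fibreEquiv μ ν π j fun k =>
      koopman (F (t * a k)) (hF (t * a k)) (f k) := funext fun t =>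
    (congrArg _ hψ).trans (conjugateGroup_fibreEquiv hF π j a t f)
  simp only [hsmul, hfun]
  refine (hasDerivAt_fibreEquiv π j).2 fun k => ?_
  exact hasDerivAt_mul_of_mem_graph_generator
    (LinearPMap.le_graph_of_le hT (LinearPMap.mem_graph T ⟨f k, hdom k⟩)) (a k)

section Smooth

variable (E : Type*) [NormedAddCommGroup E] [NormedSpace ℝ E] [ChartedSpace E X]
  [SecondCountableTopology G]

theorem fibreEquiv_mem_conjugateOp_domain (f : Fin d → Lp ℂ 2 μ) :
    fibreEquiv μ ν π j f ∈ (conjugateOp E ν F hF π j a).domain ↔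
      ∀ k, f k ∈ smoothL2 E μ ⊓ (flowGenerator F hF).domain := by
  change (fibreEquiv μ ν π j).symm (fibreEquiv μ ν π j f) ∈
    Submodule.pi Set.univ (fun _ => smoothL2 E μ ⊓ (flowGenerator F hF).domain) ↔ _
  rw [ContinuousLinearEquiv.symm_apply_apply]
  simp only [Submodule.mem_pi, Set.mem_univ, forall_const]

theorem conjugateOp_le_generator :
    conjugateOp E ν F hF π j a ≤ generator (conjugateGroup ν F hF π j a) :=
  diagonalOp_le_generator hF π j a LinearPMap.domRestrict_le

end Smooth

variable [T2Space X] [SecondCountableTopology X]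

theorem isUnitaryGroup_conjugateGroup : IsUnitaryGroup (conjugateGroup ν F hF π j a) := by
  have hs := (fibreEquiv μ ν π j).surjective
  refine .of_norm_map ?_ (fun s t => ?_) (fun t x => ?_) fun x => ?_
  · ext1 x
    obtain ⟨f, rfl⟩ := hs x
    rw [conjugateGroup_fibreEquiv]
    change _ = fibreEquiv μ ν π j f
    congr 1
    ext1 k
    rw [koopman_of_eq_zero hF (zero_mul _)]
    rfl
  · ext1 x
    obtain ⟨f, rfl⟩ := hs x
    rw [ContinuousLinearMap.comp_apply]
    simp only [conjugateGroup_fibreEquiv]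
    congr 1
    ext1 k
    exact (koopman_koopman hF (add_mul s t (a k)).symm (f k)).symm
  · obtain ⟨f, rfl⟩ := hs x
    rw [conjugateGroup_fibreEquiv]
    exact norm_fibreEquiv_eq π j fun k => norm_koopman _ _
  · obtain ⟨f, rfl⟩ := hs x
    simp only [conjugateGroup_fibreEquiv]
    refine (fibreEquiv μ ν π j).continuous.comp (continuous_pi fun k => ?_)
    exact (continuous_koopman hF (f k)).comp (continuous_mul_const (a k))

section Core

variable {E : Type*} [NormedAddCommGroup E] [NormedSpace ℝ E] [FiniteDimensional ℝ E]
  [ChartedSpace E X] [IsManifold 𝓘(ℝ, E) ∞ X] [SecondCountableTopology G]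
  (hFs : ContMDiff (𝓘(ℝ, ℝ).prod 𝓘(ℝ, E)) 𝓘(ℝ, E) ∞ fun p : ℝ × X => F p.1 p.2)
include hFs

theorem dense_conjugateOp_domain :
    Dense ((conjugateOp E ν F hF π j a).domain : Set (fibre μ ν π j)) := by
  have h1 : Dense (Set.univ.pi fun _ : Fin d => (smoothL2 E μ : Set (Lp ℂ 2 μ))) :=
    dense_pi _ fun _ _ => dense_smoothL2
  have h2 := (fibreEquiv μ ν π j).surjective.denseRange.dense_image
    (fibreEquiv μ ν π j).continuous h1
  refine h2.mono ?_
  rintro _ ⟨f, hf, rfl⟩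
  refine (fibreEquiv_mem_conjugateOp_domain hF π j a E f).2 fun k => ?_
  have hk := hf k (Set.mem_univ k)
  exact ⟨hk, smoothL2_le_domain hFs hF hk⟩

theorem conjugateGroup_mem_conjugateOp_domain (t : ℝ) (x : fibre μ ν π j)
    (hx : x ∈ (conjugateOp E ν F hF π j a).domain) :
    conjugateGroup ν F hF π j a t x ∈ (conjugateOp E ν F hF π j a).domain := by
  obtain ⟨f, rfl⟩ := (fibreEquiv μ ν π j).surjective x
  rw [fibreEquiv_mem_conjugateOp_domain] at hx
  rw [conjugateGroup_fibreEquiv, fibreEquiv_mem_conjugateOp_domain]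
  intro k
  have h1 := koopman_mem_smoothL2 hFs hF (t * a k) (hx k).1
  exact ⟨h1, smoothL2_le_domain hFs hF h1⟩

/-- Smooth tuples form a core: they are dense, lie in the domain of the generator, and are preserved
by the group since composition with a smooth flow keeps functions smooth. -/
theorem isClosable_and_closure_conjugateOp :
    (conjugateOp E ν F hF π j a).IsClosable ∧
      (conjugateOp E ν F hF π j a).closure = generator (conjugateGroup ν F hF π j a) :=
  (isUnitaryGroup_conjugateGroup hF π j a).isClosable_and_closure_eq_generator
    (conjugateOp_le_generator hF π j a E) (dense_conjugateOp_domain hF π j a hFs)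
    (conjugateGroup_mem_conjugateOp_domain hF π j a hFs)

theorem dense_generator_conjugateGroup_domain :
    Dense ((generator (conjugateGroup ν F hF π j a)).domain : Set (fibre μ ν π j)) :=
  (dense_conjugateOp_domain hF π j a hFs).mono (conjugateOp_le_generator hF π j a E).1

theorem expI_closure_conjugateOp :
    expI (conjugateOp E ν F hF π j a).closure = conjugateGroup ν F hF π j a := by
  rw [(isClosable_and_closure_conjugateOp hF π j a hFs).2]
  exact (isUnitaryGroup_conjugateGroup hF π j a).expI_generator
    (dense_generator_conjugateGroup_domain hF π j a hFs)

end Core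

end ConjugateGroup

/-! ### Matrix-weighted Koopman operators -/

section WeightedKoopman

variable {X G : Type*} [TopologicalSpace X] [CompactSpace X] [MeasurableSpace X] [BorelSpace X]
  [Group G] [TopologicalSpace G] [IsTopologicalGroup G] [CompactSpace G]
  [MeasurableSpace G] [BorelSpace G]
  {μ : Measure X} {ν : Measure G} [IsProbabilityMeasure μ]
  [IsProbabilityMeasure ν] [ν.IsHaarMeasure] {d : ℕ}

variable (ν) in
/-- The operator `∑_k φ_k ⊗ π_{jk} ↦ ∑_{l,k} c_{lk} (φ_k ∘ F_1) ⊗ π_{jl}`, as a bounded linear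
function of the matrix `c` of continuous functions. -/
def weightedKoopman (F : Flow ℝ X) (hF : ∀ t, MeasurePreserving (F t) μ μ) (π : IUR G d)
    (j : Fin d) :
    (Fin d → Fin d → C(X, ℂ)) →L[ℂ] (fibre μ ν π j →L[ℂ] fibre μ ν π j) :=
  ∑ l, ∑ k, (ContinuousLinearMap.postcomp (fibre μ ν π j)
      ((fibreEquiv μ ν π j : (Fin d → Lp ℂ 2 μ) →L[ℂ] fibre μ ν π j) ∘L
        ContinuousLinearMap.single ℂ (fun _ : Fin d => Lp ℂ 2 μ) l)) ∘L
    (ContinuousLinearMap.precomp (Lp ℂ 2 μ)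
      (koopman (F 1) (hF 1) ∘L ContinuousLinearMap.proj k ∘L
        ((fibreEquiv μ ν π j).symm : fibre μ ν π j →L[ℂ] (Fin d → Lp ℂ 2 μ)))) ∘L
    mulOpL μ ∘L ContinuousLinearMap.proj k ∘L ContinuousLinearMap.proj l

variable {F : Flow ℝ X} (hF : ∀ t, MeasurePreserving (F t) μ μ) (π : IUR G d) (j : Fin d)

theorem weightedKoopman_fibreEquiv (c : Fin d → Fin d → C(X, ℂ)) (f : Fin d → Lp ℂ 2 μ) :
    weightedKoopman ν F hF π j c (fibreEquiv μ ν π j f) =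
      fibreEquiv μ ν π j fun l => ∑ k, mulOpL μ (c l k) (koopman (F 1) (hF 1) (f k)) := by
  rw [← Finset.univ_sum_single fun l => ∑ k, mulOpL μ (c l k) (koopman (F 1) (hF 1) (f k)),
    map_sum]
  simp only [weightedKoopman, _root_.sum_apply]
  refine Finset.sum_congr rfl fun l _ => ?_
  have h := map_sum ((fibreEquiv μ ν π j : (Fin d → Lp ℂ 2 μ) →L[ℂ] fibre μ ν π j) ∘L
    ContinuousLinearMap.single ℂ (fun _ : Fin d => Lp ℂ 2 μ) l)
    (fun k : Fin d => mulOpL μ (c l k) (koopman (F 1) (hF 1) (f k))) Finset.univ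
  refine Eq.trans ?_ h.symm
  refine Finset.sum_congr rfl fun k _ => ?_
  simp only [ContinuousLinearMap.comp_apply, ContinuousLinearMap.precomp_apply,
    ContinuousLinearMap.postcomp_apply, ContinuousLinearMap.proj_apply,
    ContinuousLinearEquiv.coe_coe, ContinuousLinearEquiv.symm_apply_apply]

theorem matrixOp_fibreEquiv (T : Fin d → Fin d → Lp ℂ 2 μ →L[ℂ] Lp ℂ 2 μ)
    (f : Fin d → Lp ℂ 2 μ) :
    matrixOp μ ν π j T (fibreEquiv μ ν π j f) = fibreEquiv μ ν π j fun k => ∑ l, T k l (f l) := by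
  simp only [matrixOp, ContinuousLinearMap.comp_apply, ContinuousLinearEquiv.coe_coe,
    ContinuousLinearEquiv.symm_apply_apply]
  congr 1
  ext1 k
  simp

theorem matrixOp_comp_weightedKoopman (m c : Fin d → Fin d → C(X, ℂ)) :
    matrixOp μ ν π j (fun k l => mulOpL μ (m k l)) ∘L weightedKoopman ν F hF π j c =
      weightedKoopman ν F hF π j fun k n => ∑ l, m k l * c l n := by
  ext1 x
  obtain ⟨f, rfl⟩ := (fibreEquiv μ ν π j).surjective x
  rw [ContinuousLinearMap.comp_apply, weightedKoopman_fibreEquiv, matrixOp_fibreEquiv,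
    weightedKoopman_fibreEquiv]
  congr 1
  ext1 k
  simp only [map_sum, _root_.sum_apply, mulOpL_mul_apply]
  exact Finset.sum_comm

/-- The functions `c_{lk} ∘ F_{-t a_l}`. -/
def flowMatrix (F : Flow ℝ X) (a : Fin d → ℝ) (c : Fin d → Fin d → C(X, ℂ)) (t : ℝ) :
    Fin d → Fin d → C(X, ℂ) :=
  fun l k => flowComp F (-(t * a l)) (c l k)

/-- Conjugating a weighted Koopman operator by the unitary group transports its weights, provided
the weights only couple components with equal speed. -/
theorem conjugateGroup_weightedKoopman {a : Fin d → ℝ} {c : Fin d → Fin d → C(X, ℂ)}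
    (hc : ∀ l k, a k ≠ a l → c l k = 0) (t : ℝ) :
    conjugateGroup ν F hF π j a (-t) ∘L weightedKoopman ν F hF π j c ∘L
      conjugateGroup ν F hF π j a t = weightedKoopman ν F hF π j (flowMatrix F a c t) := by
  ext1 x
  obtain ⟨f, rfl⟩ := (fibreEquiv μ ν π j).surjective x
  simp only [ContinuousLinearMap.comp_apply, conjugateGroup_fibreEquiv,
    weightedKoopman_fibreEquiv]
  congr 1
  ext1 l
  rw [map_sum]
  refine Finset.sum_congr rfl fun k _ => ?_
  rw [koopman_mulOpL, flowMatrix]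
  -- For equal speeds the times add up to `-t a_l + 1 + t a_k = 1`, so the Koopman part is
  -- unchanged; for different speeds the weight is zero.
  by_cases h : a k = a l
  · rw [koopman_koopman hF rfl, koopman_koopman hF (r := 1) (by rw [h]; ring), neg_mul]
  · rw [hc l k h]
    have h0 : ∀ s, flowComp F s (0 : C(X, ℂ)) = 0 := fun s => rfl
    simp only [h0, map_zero, _root_.zero_apply]

variable [T2Space X] [SecondCountableTopology X]

theorem continuous_flowMatrix (a : Fin d → ℝ) (c : Fin d → Fin d → C(X, ℂ)) :
    Continuous (flowMatrix F a c) :=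
  continuous_pi fun l => continuous_pi fun k =>
    (continuous_flowComp F (c l k)).comp (continuous_mul_const (a l)).neg

theorem hasDerivAt_flowMatrix (a : Fin d → ℝ) {c c' : Fin d → Fin d → C(X, ℂ)}
    (h : ∀ l k x, HasDerivAt (fun t : ℝ => c l k (F t x)) (c' l k x) 0) (t : ℝ) :
    HasDerivAt (flowMatrix F a c) (flowMatrix F a (fun l k => (-(a l : ℂ)) • c' l k) t) t := by
  refine hasDerivAt_pi.2 fun l => hasDerivAt_pi.2 fun k => ?_
  have h1 := (hasDerivAt_flowComp (h l k) (-(t * a l))).scomp t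
    ((hasDerivAt_id t).mul_const (a l)).neg
  refine h1.congr_deriv ?_
  ext x
  simp [flowMatrix, Complex.real_smul]

end WeightedKoopman

/-! ### The commutator with the Koopman operator of the skew product -/

section Commutator

variable {X G : Type*} [TopologicalSpace X] [CompactSpace X] [T2Space X]
  [SecondCountableTopology X] [MeasurableSpace X] [BorelSpace X]
  [Group G] [TopologicalSpace G] [IsTopologicalGroup G] [CompactSpace G]
  [SecondCountableTopology G] [MeasurableSpace G] [BorelSpace G]
  {μ : Measure X} {ν : Measure G} [IsProbabilityMeasure μ] [μ.IsOpenPosMeasure]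
  [IsProbabilityMeasure ν] [ν.IsHaarMeasure] {d : ℕ}
  {F : Flow ℝ X} (hF : ∀ t, MeasurePreserving (F t) μ μ) {φ : C(X, G)} {π : IUR G d} (j : Fin d)
  {a : Fin d → ℝ}

/-- The functions `π_{lk} ∘ φ`. -/
def cocycleMatrix (φ : C(X, G)) (π : IUR G d) (l k : Fin d) : C(X, ℂ) :=
  (π.entry l k).comp φ

theorem fibreKoopman_eq_weightedKoopman :
    fibreKoopman ν F hF φ π j = weightedKoopman ν F hF π j (cocycleMatrix φ π) := by
  ext1 x
  obtain ⟨f, rfl⟩ := (fibreEquiv μ ν π j).surjective x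
  rw [weightedKoopman_fibreEquiv]
  exact Subtype.ext (skewKoopman_tensorSum F hF φ π j f)

theorem cocycleMatrix_eq_zero
    (hcomm : ∀ k l x, ((a k : ℂ) - (a l : ℂ)) * π.entry l k (φ x) = 0) (l k : Fin d)
    (h : a k ≠ a l) : cocycleMatrix φ π l k = 0 := by
  ext x
  exact (mul_eq_zero.1 (hcomm k l x)).resolve_left (sub_ne_zero.2 (Complex.ofReal_injective.ne h))

theorem sum_conj_cocycleMatrix_mul (m n : Fin d) (x : X) :
    ∑ l, starRingEnd ℂ (cocycleMatrix φ π l m x) * cocycleMatrix φ π l n x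
      = if m = n then 1 else 0 := by
  have h : star (π.toHom (φ x) : Matrix (Fin d) (Fin d) ℂ) *
      (π.toHom (φ x) : Matrix (Fin d) (Fin d) ℂ) = 1 :=
    Unitary.star_mul_self_of_mem (π.toHom (φ x)).2
  have h' := congrFun (congrFun h m) n
  rwa [Matrix.mul_apply, Matrix.one_apply] at h'

theorem lieDeriv_eq_zero {m : C(X, ℂ)} (hm : m = 0) : lieDeriv F m = 0 := by
  subst hm
  ext x
  simp [lieDeriv]

/-- In each summand `m`, either `a_m ≠ a_k`, and `π_{km} ∘ φ` vanishes together with its Lie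
derivative, or `a_m = a_k ≠ a_l`, and `π_{lm} ∘ φ` vanishes. -/
theorem commutatorEntry_eq_zero
    (hcomm : ∀ k l x, ((a k : ℂ) - (a l : ℂ)) * π.entry l k (φ x) = 0) {k l : Fin d}
    (h : a k ≠ a l) : commutatorEntry F φ π a k l = 0 := by
  ext x
  rw [commutatorEntry, Finset.sum_eq_zero fun m _ => ?_, mul_zero]
  · rfl
  by_cases hm : a m = a k
  · have h1 := DFunLike.congr_fun (cocycleMatrix_eq_zero hcomm l m (hm ▸ h)) x
    rw [show π.entry l m (φ x) = 0 from h1, map_zero, mul_zero]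
  · have h1 := congrFun (lieDeriv_eq_zero (F := F) (cocycleMatrix_eq_zero hcomm k m hm)) x
    rw [show lieDeriv F (fun y => π.entry k m (φ y)) x = 0 from h1, zero_mul]

variable (hφ : CocycleAssumption μ F φ π)
include hφ

theorem hasDerivAt_cocycleMatrix (l k : Fin d) (x : X) :
    HasDerivAt (fun t : ℝ => cocycleMatrix φ π l k (F t x))
      (lieDeriv F (cocycleMatrix φ π l k) x) 0 :=
  (hφ.differentiable l k x).hasDerivAt

theorem continuous_lieDeriv_cocycleMatrix (l k : Fin d) :
    Continuous (lieDeriv F (cocycleMatrix φ π l k)) :=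
  continuous_lieDeriv_of_dini (hasDerivAt_cocycleMatrix hφ l k) (hφ.dini l k)

theorem continuous_commutatorEntry (k l : Fin d) : Continuous (commutatorEntry F φ π a k l) :=
  continuous_const.mul <| continuous_finsetSum _ fun m _ =>
    (continuous_lieDeriv_cocycleMatrix hφ k m).mul
      (Complex.continuous_conj.comp (cocycleMatrix φ π l m).continuous)

/-- The Lie derivatives of the functions `π_{lk} ∘ φ`. -/
def lieCocycleMatrix (l k : Fin d) : C(X, ℂ) :=
  ⟨lieDeriv F (cocycleMatrix φ π l k), continuous_lieDeriv_cocycleMatrix hφ l k⟩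

/-- Unitarity of `π` cancels the factor `π^* ∘ φ` in `M` against the weights `π ∘ φ` of `U_{π,j}`.
-/
theorem commutatorOp_comp_fibreKoopman :
    commutatorOp μ ν F φ π j a ∘L fibreKoopman ν F hF φ π j =
      weightedKoopman ν F hF π j fun l k =>
        (-Complex.I * (a l : ℂ)) • lieCocycleMatrix hφ l k := by
  rw [fibreKoopman_eq_weightedKoopman]
  refine (matrixOp_comp_weightedKoopman hF π j
    (fun k l => ⟨commutatorEntry F φ π a k l, continuous_commutatorEntry hφ k l⟩)
    (cocycleMatrix φ π)).trans ?_
  congr 1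
  ext k n x
  simp only [ContinuousMap.sum_apply, ContinuousMap.mul_apply, ContinuousMap.coe_mk,
    ContinuousMap.smul_apply, smul_eq_mul]
  have h1 : ∀ l, commutatorEntry F φ π a k l x * cocycleMatrix φ π l n x =
      -Complex.I * (a k : ℂ) * ∑ m, lieCocycleMatrix hφ k m x *
        (starRingEnd ℂ (cocycleMatrix φ π l m x) * cocycleMatrix φ π l n x) := fun l => by
    rw [commutatorEntry, mul_assoc, Finset.sum_mul]
    simp only [mul_assoc]
    rfl
  simp only [h1, ← Finset.mul_sum]
  rw [Finset.sum_comm]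
  simp only [← Finset.mul_sum, sum_conj_cocycleMatrix_mul]
  simp

theorem lieCocycleMatrix_eq_zero
    (hcomm : ∀ k l x, ((a k : ℂ) - (a l : ℂ)) * π.entry l k (φ x) = 0) (l k : Fin d)
    (h : a k ≠ a l) : lieCocycleMatrix hφ l k = 0 := by
  ext x
  exact congrFun (lieDeriv_eq_zero (F := F) (cocycleMatrix_eq_zero hcomm l k h)) x

/-- The conjugated operator is a bounded linear image of its matrix of weights, and that matrix is
differentiable in sup norm along the flow. -/
theorem hasDerivAt_conjugateGroup_fibreKoopman
    (hcomm : ∀ k l x, ((a k : ℂ) - (a l : ℂ)) * π.entry l k (φ x) = 0) (t : ℝ)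
    (x : fibre μ ν π j) :
    HasDerivAt (fun t => (conjugateGroup ν F hF π j a (-t) ∘L fibreKoopman ν F hF φ π j ∘L
        conjugateGroup ν F hF π j a t) x)
      (weightedKoopman ν F hF π j
        (flowMatrix F a (fun l k => (-(a l : ℂ)) • lieCocycleMatrix hφ l k) t) x) t := by
  simp only [fibreKoopman_eq_weightedKoopman,
    conjugateGroup_weightedKoopman hF π j (cocycleMatrix_eq_zero hcomm)]
  have h1 := hasDerivAt_flowMatrix a (c' := lieCocycleMatrix hφ) (hasDerivAt_cocycleMatrix hφ) t
  exact hasDerivAt_clm (((ContinuousLinearMap.apply ℂ (fibre μ ν π j)) x) ∘L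
    weightedKoopman ν F hF π j) h1

/-- Conjugation again only moves the weights, so the operator norm is at most a constant times a
finite sum of sup norms of increments of the Lie derivatives, each run at speed `-a_l`. -/
theorem lintegral_conjugateGroup_commutatorOp_lt_top
    (hcomm : ∀ k l x, ((a k : ℂ) - (a l : ℂ)) * π.entry l k (φ x) = 0) :
    ∫⁻ t in Set.Ioo (0 : ℝ) 1, ‖conjugateGroup ν F hF π j a (-t) ∘L
      (commutatorOp μ ν F φ π j a ∘L fibreKoopman ν F hF φ π j) ∘L
        conjugateGroup ν F hF π j a t -
          (commutatorOp μ ν F φ π j a ∘L fibreKoopman ν F hF φ π j)‖ₑ / ENNReal.ofReal t < ⊤ := by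
  have hc : ∀ l k, a k ≠ a l → (-Complex.I * (a l : ℂ)) • lieCocycleMatrix hφ l k = 0 :=
    fun l k h => by rw [lieCocycleMatrix_eq_zero hφ hcomm l k h, smul_zero]
  rw [commutatorOp_comp_fibreKoopman hF j hφ]
  simp only [conjugateGroup_weightedKoopman hF π j hc, ← map_sub]
  set S := weightedKoopman ν F hF π j
  set D : Fin d → Fin d → ℝ → ENNReal := fun l k t =>
    ‖flowComp F (-(t * a l)) (lieCocycleMatrix hφ l k) - lieCocycleMatrix hφ l k‖ₑ
  have hbound : ∀ c : Fin d → Fin d → C(X, ℂ), ‖c‖ ≤ ∑ l, ∑ k, ‖c l k‖ := fun c => by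
    refine (pi_norm_le_iff_of_nonneg (by positivity)).2 fun l =>
      (pi_norm_le_iff_of_nonneg (by positivity)).2 fun k => ?_
    exact (Finset.single_le_sum (f := fun k => ‖c l k‖) (fun _ _ => norm_nonneg _)
      (Finset.mem_univ k)).trans (Finset.single_le_sum (f := fun l => ∑ k, ‖c l k‖)
        (fun _ _ => by positivity) (Finset.mem_univ l))
  obtain ⟨K, hK0, hK⟩ := ContinuousLinearMap.bound (E := Fin d → Fin d → C(X, ℂ))
    (F := fibre μ ν π j →L[ℂ] fibre μ ν π j) (σ₁₂ := RingHom.id ℂ) S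
  have hle : ∀ t : ℝ, ‖S (flowMatrix F a (fun l k =>
      (-Complex.I * (a l : ℂ)) • lieCocycleMatrix hφ l k) t -
        fun l k => (-Complex.I * (a l : ℂ)) • lieCocycleMatrix hφ l k)‖ₑ / ENNReal.ofReal t ≤
      ∑ l, ∑ k, ENNReal.ofReal (K * |a l|) * (D l k t / ENNReal.ofReal t) := by
    intro t
    set c := flowMatrix F a (fun l k =>
      (-Complex.I * (a l : ℂ)) • lieCocycleMatrix hφ l k) t -
        fun l k => (-Complex.I * (a l : ℂ)) • lieCocycleMatrix hφ l k
    have hcn : ∀ l k, ‖c l k‖ = |a l| *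
        ‖flowComp F (-(t * a l)) (lieCocycleMatrix hφ l k) - lieCocycleMatrix hφ l k‖ := by
      intro l k
      have h1 : c l k = (-Complex.I * (a l : ℂ)) •
          (flowComp F (-(t * a l)) (lieCocycleMatrix hφ l k) - lieCocycleMatrix hφ l k) := by
        rw [smul_sub]
        rfl
      rw [h1, norm_smul, norm_mul, norm_neg, Complex.norm_I, one_mul, Complex.norm_real,
        Real.norm_eq_abs]
    have h1 : ‖S c‖ ≤ ∑ l, ∑ k, K * |a l| *
        ‖flowComp F (-(t * a l)) (lieCocycleMatrix hφ l k) - lieCocycleMatrix hφ l k‖ := by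
      refine (hK c).trans ((mul_le_mul_of_nonneg_left (hbound c) hK0.le).trans ?_)
      simp only [Finset.mul_sum, hcn, mul_assoc]
      exact le_rfl
    have h2 : ‖S c‖ₑ ≤ ∑ l, ∑ k, ENNReal.ofReal (K * |a l|) * D l k t := by
      rw [← ofReal_norm]
      refine (ENNReal.ofReal_le_ofReal h1).trans ?_
      rw [ENNReal.ofReal_sum_of_nonneg fun l _ => by positivity]
      refine Finset.sum_le_sum fun l _ => ?_
      rw [ENNReal.ofReal_sum_of_nonneg fun k _ => by positivity]
      refine Finset.sum_le_sum fun k _ => ?_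
      rw [ENNReal.ofReal_mul (by positivity), ofReal_norm]
    refine (ENNReal.div_le_div_right h2 _).trans (le_of_eq ?_)
    simp only [div_eq_mul_inv, Finset.sum_mul, mul_assoc]
  have hmeas : ∀ l k, Measurable fun t =>
      ENNReal.ofReal (K * |a l|) * (D l k t / ENNReal.ofReal t) := fun l k => by
    have hD : Continuous (D l k) :=
      (((continuous_flowComp F (lieCocycleMatrix hφ l k)).comp
        (continuous_mul_const (a l)).neg).sub continuous_const).enorm
    exact (hD.measurable.div ENNReal.measurable_ofReal).const_mul _
  -- The hypothesis is in `L^∞`. The Lie derivatives being continuous, it bounds sup norms as well,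
  -- and rescaling of time brings in `a_l`.
  have hdini : ∀ l k, ∫⁻ t in Set.Ioo (0 : ℝ) 1, D l k t / ENNReal.ofReal t < ⊤ := by
    intro l k
    refine lintegral_flowComp_mul_lt_top (lt_of_le_of_lt ?_ (hφ.dini l k)) (a l)
    exact lintegral_mono fun t => ENNReal.div_le_div_right
      (enorm_le_eLpNorm_top (flowComp F t (lieCocycleMatrix hφ l k) - lieCocycleMatrix hφ l k)) _
  refine (lintegral_mono hle).trans_lt ?_
  rw [lintegral_finsetSum _ fun l _ => Finset.measurable_sum _ fun k _ => hmeas l k]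
  refine ENNReal.sum_lt_top.2 fun l _ => ?_
  rw [lintegral_finsetSum _ fun k _ => hmeas l k]
  refine ENNReal.sum_lt_top.2 fun k _ => ?_
  rw [lintegral_const_mul' _ _ ENNReal.ofReal_ne_top]
  exact ENNReal.mul_lt_top ENNReal.ofReal_lt_top (hdini l k)

end Commutator

end SkewProduct

end

/-! ### Assembly of (a), (b) and (c) -/

open SkewProduct
theorem lemma3p2
    -- the compact Lie group `X` with its normalised Haar measure
    {E : Type*} [NormedAddCommGroup E] [NormedSpace ℝ E] [FiniteDimensional ℝ E]
    {X : Type*} [TopologicalSpace X] [ChartedSpace E X] [Group X] [LieGroup 𝓘(ℝ, E) ∞ X]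
    [CompactSpace X] [T2Space X] [SecondCountableTopology X]
    [MeasurableSpace X] [BorelSpace X]
    (μ : Measure X) [μ.IsHaarMeasure] [IsProbabilityMeasure μ]
    -- the compact Lie group `G` with its normalised Haar measure
    {E' : Type*} [NormedAddCommGroup E'] [NormedSpace ℝ E'] [FiniteDimensional ℝ E']
    {G : Type*} [TopologicalSpace G] [ChartedSpace E' G] [Group G] [LieGroup 𝓘(ℝ, E') ∞ G]
    [IsTopologicalGroup G] [CompactSpace G] [T2Space G] [SecondCountableTopology G]
    [MeasurableSpace G] [BorelSpace G]
    (ν : Measure G) [ν.IsHaarMeasure] [IsProbabilityMeasure ν]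
    -- the smooth measure-preserving flow
    (F : Flow ℝ X)
    (hF : ContMDiff (𝓘(ℝ, ℝ).prod 𝓘(ℝ, E)) 𝓘(ℝ, E) ∞ fun p : ℝ × X => F p.1 p.2)
    (hFμ : ∀ t, MeasurePreserving (F t) μ μ)
    -- the cocycle, the representation, the row index and the scalars `a_k`
    (φ : C(X, G)) {d : ℕ} (π : IUR G d) (j : Fin d) (a : Fin d → ℝ)
    (hφ : CocycleAssumption μ F φ π)
    (hcomm : ∀ k l x, ((a k : ℂ) - (a l : ℂ)) * π.entry l k (φ x) = 0) :
    -- the objects are well defined: `C^∞(X) ⊆ dom(H)`, `e^{itH} = V_t`, and the functions `M_{kℓ}`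
    -- are continuous
    (smoothL2 E μ ≤ (flowGenerator F hFμ).domain ∧
      (∀ t, expI (flowGenerator F hFμ) t = koopman (F t) (hFμ t)) ∧
      ∀ k l, Continuous (commutatorEntry F φ π a k l)) ∧
    -- (a)
    (IsEssentiallySelfAdjoint (conjugateOp E ν F hFμ π j a) ∧
      (∀ f : Fin d → Lp ℂ 2 μ, fibreEquiv μ ν π j f ∈ (conjugateOp E ν F hFμ π j a).closure.domain ↔
        ∀ k, a k ≠ 0 → f k ∈ (flowGenerator F hFμ).domain) ∧
      IsUnitaryGroup (expI (conjugateOp E ν F hFμ π j a).closure) ∧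
      generator (expI (conjugateOp E ν F hFμ π j a).closure) =
        (conjugateOp E ν F hFμ π j a).closure ∧
      ∀ (t : ℝ) (f : Fin d → Lp ℂ 2 μ),
        expI (conjugateOp E ν F hFμ π j a).closure t (fibreEquiv μ ν π j f) =
          fibreEquiv μ ν π j fun k => expI (flowGenerator F hFμ) (t * a k) (f k)) ∧
    -- (b)
    (∀ (k l : Fin d) (t : ℝ),
      ‖expI (flowGenerator F hFμ) (-(t * a k)) ∘L commutatorEntryOp μ F φ π a k l ∘L
          expI (flowGenerator F hFμ) (t * a l) - commutatorEntryOp μ F φ π a k l‖ =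
        ‖expI (flowGenerator F hFμ) (-(t * a k)) ∘L commutatorEntryOp μ F φ π a k l ∘L
          expI (flowGenerator F hFμ) (t * a k) - commutatorEntryOp μ F φ π a k l‖) ∧
    -- (c)
    (IsC1Plus (conjugateOp E ν F hFμ π j a).closure (fibreKoopman ν F hFμ φ π j) ∧
      IsCommutator (conjugateOp E ν F hFμ π j a).closure (fibreKoopman ν F hFμ φ π j)
        (commutatorOp μ ν F φ π j a ∘L fibreKoopman ν F hFμ φ π j)) := by
  have hman : IsManifold 𝓘(ℝ, E) ∞ X := inferInstance
  have hopen : μ.IsOpenPosMeasure := inferInstance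
  have hV := expI_flowGenerator hF hFμ
  obtain ⟨hclosable, hclosure⟩ := isClosable_and_closure_conjugateOp (ν := ν) hFμ π j a hF
  have hW := expI_closure_conjugateOp (ν := ν) hFμ π j a hF
  have hWu := isUnitaryGroup_conjugateGroup (ν := ν) hFμ π j a
  have hcommutator : IsCommutator (conjugateOp E ν F hFμ π j a).closure
      (fibreKoopman ν F hFμ φ π j)
      (commutatorOp μ ν F φ π j a ∘L fibreKoopman ν F hFμ φ π j) := by
    intro x
    simp only [conjugated, hW]
    have h1 := hasDerivAt_conjugateGroup_fibreKoopman (ν := ν) hFμ j hφ hcomm 0 x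
    rw [commutatorOp_comp_fibreKoopman hFμ j hφ]
    refine h1.congr_deriv ?_
    rw [← smul_apply, ← map_smul]
    congr 2
    ext l k y
    simp only [flowMatrix, zero_mul, neg_zero, flowComp_apply, Flow.map_zero_apply,
      Pi.smul_apply, ContinuousMap.smul_apply, smul_eq_mul]
    -- Sign check: `-i · (-i a_l) = -a_l`, the speed at which conjugation moves the weights.
    linear_combination (-(a l : ℂ) * lieCocycleMatrix hφ l k y) * Complex.I_mul_I
  refine ⟨⟨smoothL2_le_domain hF hFμ, hV, continuous_commutatorEntry hφ⟩,
    ⟨⟨hclosable, ?_⟩, fun f => ?_, ?_, ?_, fun t f => ?_⟩, fun k l t => ?_,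
    ⟨fun x => ?_, _, hcommutator, ?_⟩, hcommutator⟩
  · rw [hclosure]
    exact hWu.isSelfAdjoint_generator (dense_generator_conjugateGroup_domain hFμ π j a hF)
  · rw [hclosure]
    exact fibreEquiv_mem_generator_domain hFμ π j a f
  · rw [hW]
    exact hWu
  · rw [hW, hclosure]
  · rw [hW, conjugateGroup_fibreEquiv]
    simp only [hV]
  -- If the speeds agree the two sides are literally equal; otherwise `M_{kl} = 0` and both norms
  -- vanish.
  · by_cases h : a k = a l
    · rw [h]
    · have h0 : commutatorEntryOp μ F φ π a k l = 0 := by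
        rw [commutatorEntryOp, commutatorEntry_eq_zero hcomm h]
        exact map_zero (mulOpL μ)
      simp only [h0, ContinuousLinearMap.zero_comp, ContinuousLinearMap.comp_zero]
  · simp only [conjugated, hW]
    have h1 := fun t => hasDerivAt_conjugateGroup_fibreKoopman (ν := ν) hFμ j hφ hcomm t x
    -- The derivative is known at every `t`, again as a weighted Koopman operator with transported
    -- continuous weights, so it is continuous in `t`.
    refine contDiff_one_iff_deriv.2 ⟨fun t => (h1 t).differentiableAt, ?_⟩
    refine Continuous.congr ?_ fun t => (h1 t).deriv.symm
    exact (((ContinuousLinearMap.apply ℂ (fibre μ ν π j)) x) ∘L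
      weightedKoopman ν F hFμ π j).continuous.comp (continuous_flowMatrix a _)
  · simp only [conjugated, hW]
    exact lintegral_conjugateGroup_commutatorOp_lt_top hFμ j hφ hcomm
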